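/- Conventions. A subset $C\subseteq\omega_1$ is a *club* if it is closed and unbounded, and $S\subseteq\omega_1$ is *stationary* if it meets every club. $\mathrm{MA}_{\omega_1}$ is the assertion that for every nonempty partial order satisfying the countable chain condition and every family of $\aleph_1$ dense subsets there is a filter meeting all of them. $(\dagger)$ is the assertion that if $S\subseteq\omega_1$ is stationary and $U_\alpha\subseteq\alpha$ is open for each $\alpha\in S$, then there is a club $E\subseteq\omega_1$ such that for stationarily many $\alpha\in S\cap E$ there is $\bar\alpha<\alpha$ with either $E\cap(\bar\alpha,\alpha)\subseteq U_\alpha$ or $E\cap(\bar\alpha,\alpha)\cap U_\alpha=\emptyset$. A linear order is *$\sigma$-scattered* if it is a union of countably many suborders none of which contains a copy of $(\mathbb{Q},\le)$. A *Baumgartner type* is a set $\{x_\alpha:\alpha\in S\}$, ordered lexicographically, where $S\subseteq\omega_1$ is stationary and $x_\alpha:\omega\to\alpha$ is strictly increasing with range cofinal in $\alpha$ for each $\alpha\in S$. For a linear order $L$ let $\hat L$ be its completion: the set of all initial segments of $L$ (including $\emptyset$ and $L$) that have no greatest element or have the form $\{y\in L:y<z\}$ with $z\in L$, ordered by inclusion,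 the segment $\{y\in L:y<z\}$ being identified with $z$. A set $Z$ *captures* $x\in L$ if there is $z\in Z\cap\hat L$ such that no element of $Z\cap L$ lies strictly between $z$ and $x$. Let $[\hat L]^{\omega}$ be the collection of countably infinite subsets of $\hat L$; a *club* in it is a subcollection that is cofinal under inclusion and closed under unions of increasing $\omega$-sequences. Let $\theta_L$ be the least regular cardinal such that all finite iterates of the power set operation applied to (the underlying set of) $L$ belong to $H(\theta_L)$, the collection of sets of hereditary cardinality less than $\theta_L$. The linear order $L$ is *amenable* if for every countable elementary submodel $M$ of $(H(\theta_L),\in)$ with $L$ (its underlying set and its order relation) an element of $M$, and every $x\in L$, there is a club $E\subseteq[\hat L]^{\omega}$ with $E\in M$ such that every element of $E\cap M$ captures $x$. **Theorem.** Assume $\mathrm{MA}_{\omega_1}$ and $(\dagger)$. If $L$ is an amenable linear order of cardinality $\aleph_1$ that is not $\sigma$-scattered, then $L$ contains an isomorphic copy of a Baumgartner type or of the reverse of a Baumgartner type. -/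

import Mathlib

open scoped Cardinal Ordinal

universe u v

namespace LinearOrderBasis

noncomputable section

/-! ### Club and stationary subsets of the first uncountable ordinal -/

/-- The first uncountable ordinal, as a type; it carries the order topology. -/
abbrev Omega1 : Type 1 := Set.Iio (ω₁ : Ordinal.{0})

/-- Closed unbounded subsets of `ω₁`. -/
def IsClub (C : Set Omega1) : Prop :=
  IsClosed C ∧ ∀ α : Omega1, ∃ β ∈ C, α ≤ β

/-- Stationary subsets of `ω₁`: those that meet every club. -/
def IsStationary (S : Set Omega1) : Prop :=
  ∀ C : Set Omega1, IsClub C → (S ∩ C).Nonempty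

/-! ### The two set-theoretic axioms -/

/-- The axiom `(†)`. The initial segment `Set.Iio α` is an open subset of `ω₁`, so a subset of it
is open in `α` exactly when it is open in `ω₁`. -/
def Dagger : Prop :=
  ∀ (S : Set Omega1) (U : Omega1 → Set Omega1), IsStationary S →
    (∀ α ∈ S, U α ⊆ Set.Iio α ∧ IsOpen (U α)) →
    ∃ E : Set Omega1, IsClub E ∧
      IsStationary {α | α ∈ S ∩ E ∧ ∃ a < α,
        E ∩ Set.Ioo a α ⊆ U α ∨ E ∩ Set.Ioo a α ∩ U α = ∅}

/-- The countable chain condition: every set of pairwise incompatible elements is countable. -/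
def CCC (P : Type v) [PartialOrder P] : Prop :=
  ∀ A : Set P, (∀ p ∈ A, ∀ q ∈ A, p ≠ q → ¬ ∃ r, r ≤ p ∧ r ≤ q) → A.Countable

/-- Martin's axiom `MA_{ω₁}`: for every nonempty ccc partial order and every family of `ℵ₁` dense
subsets there is a filter that meets all of them. -/
def MartinsAxiomOmega1 : Prop :=
  ∀ (P : Type v) [PartialOrder P] [Nonempty P], CCC P →
    ∀ D : Omega1 → Set P, (∀ ξ p, ∃ q ∈ D ξ, q ≤ p) →
      ∃ G : Order.PFilter P, ∀ ξ, ∃ p ∈ G, p ∈ D ξ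

/-! ### Scattered and `σ`-scattered orders -/

/-- A linear order is scattered if it contains no copy of the rationals. -/
def IsScattered (α : Type v) [LinearOrder α] : Prop :=
  IsEmpty (ℚ ↪o α)

/-- A linear order is `σ`-scattered if it is a union of countably many scattered suborders. -/
def IsSigmaScattered (α : Type v) [LinearOrder α] : Prop :=
  ∃ s : ℕ → Set α, (⋃ n, s n) = Set.univ ∧ ∀ n, IsScattered (s n)

/-! ### Baumgartner types -/

/-- `B` is a Baumgartner type: for some stationary `S ⊆ ω₁` and some strictly increasing cofinal
`ω`-sequences `x α` in `α` (for `α ∈ S`), it is the set `{x α : α ∈ S}`; the order on it is the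
lexicographic order of `Lex (ℕ → Omega1)`. -/
def IsBaumgartnerType (B : Set (Lex (ℕ → Omega1))) : Prop :=
  ∃ (S : Set Omega1) (x : Omega1 → ℕ → Omega1), IsStationary S ∧
    (∀ α ∈ S, StrictMono (x α) ∧ (∀ n, x α n < α) ∧ ∀ β < α, ∃ n, β < x α n) ∧
    B = (fun α => toLex (x α)) '' S

/-! ### The structures `H(θ)` and their elementary submodels -/

/-- `H(θ)`: the collection of all sets whose transitive closure has fewer than `θ` elements,
equivalently, which are included in a transitive set of cardinality less than `θ`. -/
def H (θ : Cardinal.{u}) : Set ZFSet.{u} :=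
  {x | ∃ t : ZFSet.{u}, t.IsTransitive ∧ x ⊆ t ∧ t.card < θ}

/-- The least regular cardinal `θ` such that all finite iterates of the power set operation
applied to `X` belong to `H(θ)`. -/
def theta (X : ZFSet.{u}) : Cardinal.{u} :=
  sInf {θ | θ.IsRegular ∧ ∀ n : ℕ, ZFSet.powerset^[n] X ∈ H θ}

/-- The cardinal `theta X` is indeed a regular cardinal with the required property. -/
theorem theta_spec (X : ZFSet.{u}) :
    (theta X).IsRegular ∧ ∀ n : ℕ, ZFSet.powerset^[n] X ∈ H (theta X) := by
  have hne : {θ : Cardinal.{u} | θ.IsRegular ∧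
      ∀ n : ℕ, ZFSet.powerset^[n] X ∈ H θ}.Nonempty := by
    let Y : ZFSet.{u} := ZFSet.iUnion fun n : ℕ => ZFSet.powerset^[n] X
    let t : ZFSet.{u} := ZFSet.vonNeumann Y.rank
    refine ⟨Order.succ (max ℵ₀ t.card), Cardinal.isRegular_succ (le_max_left _ _), fun n => ?_⟩
    refine ⟨t, ZFSet.isTransitive_vonNeumann _, ?_, ?_⟩
    · intro z hz
      exact ZFSet.subset_vonNeumann_self Y (ZFSet.mem_iUnion.2 ⟨n, hz⟩)
    · exact lt_of_le_of_lt (le_max_right _ _) (Order.lt_succ _)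
  exact csInf_mem hne

/-- The only relation symbol of the language of set theory. -/
inductive MemRel : ℕ → Type
  | mem : MemRel 2

/-- The first-order language of set theory. -/
def setLanguage : FirstOrder.Language := ⟨fun _ => Empty, MemRel⟩

/-- A collection of sets, as a structure with the true membership relation. -/
instance setStructure (A : Set ZFSet.{u}) : setLanguage.Structure A where
  funMap := fun f _ => f.elim
  RelMap := fun {_} r => match r with
    | MemRel.mem => fun v => (v 0).1 ∈ (v 1).1

/-! ### The completion of a linear order, and capturing

A linear order `L`, given as a type, is realised as a set through an injection `c` that
assigns sets to its points. -/

section Coded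

variable {L : Type u} [LinearOrder L] (c : L ↪ ZFSet.{u})

/-- The underlying set of `L`. -/
def carrierSet : ZFSet.{u} := ZFSet.range c

/-- The strict order of `L` as a set of ordered pairs. -/
def orderSet : ZFSet.{u} :=
  ZFSet.range fun p : {p : L × L // p.1 < p.2} => ZFSet.pair (c p.1.1) (c p.1.2)

/-- A subset of `L`, as a set. -/
def code (A : Set L) : ZFSet.{u} := ZFSet.range fun x : A => c x

/-- The (lower halves of) Dedekind cuts of `L`: the initial segments which either have no greatest
element or are of the form `{x | x < z}`, the latter being identified with the point `z`. The two
improper cuts are allowed. -/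
def IsCut (A : Set L) : Prop :=
  IsLowerSet A ∧ ((∃ z, A = Set.Iio z) ∨ ∀ a ∈ A, ∃ b ∈ A, a < b)

/-- The completion of `L`, as a set; it is ordered by inclusion. -/
def completionSet : ZFSet.{u} :=
  (carrierSet c).powerset.sep fun z => ∃ A : Set L, IsCut A ∧ z = code c A

/-- `Z` captures `x`: there is a `z ∈ Z` in the completion such that no point of `L` which is
(identified with) an element of `Z` is strictly between `z` and `x`. -/
def Captures (Z : ZFSet.{u}) (x : L) : Prop :=
  ∃ A : Set L, IsCut A ∧ code c A ∈ Z ∧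
    ∀ y : L, code c (Set.Iio y) ∈ Z →
      ¬ (A ⊂ Set.Iio y ∧ y < x) ∧ ¬ (x < y ∧ Set.Iio y ⊂ A)

end Coded

/-- `E` is a club in `[X]^ω`: a collection of countably infinite subsets of `X` that is cofinal
with respect to inclusion and closed under unions of increasing `ω`-sequences. -/
def IsClubCountable (X E : ZFSet.{u}) : Prop :=
  (∀ Z ∈ E, Z ⊆ X ∧ Z.card = ℵ₀) ∧
  (∀ Z : ZFSet.{u}, Z ⊆ X → Z.card = ℵ₀ → ∃ W ∈ E, Z ⊆ W) ∧
  (∀ f : ℕ → ZFSet.{u}, (∀ n, f n ∈ E) → (∀ n, f n ⊆ f (n + 1)) → ZFSet.iUnion f ∈ E)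

/-! ### Amenability -/

section Amenable

variable {L : Type u} [LinearOrder L] (c : L ↪ ZFSet.{u})

/-- The collection of all countable elementary submodels of `H(θ_L)` that have the linear order `L`
(its underlying set and its order relation) as an element. -/
def elementarySubmodels : Set (Set ZFSet.{u}) :=
  {M | M.Countable ∧
    (∃ N : setLanguage.ElementarySubstructure (H (theta (carrierSet c))),
      M = Subtype.val '' (N : Set (H (theta (carrierSet c))))) ∧
    carrierSet c ∈ M ∧ orderSet c ∈ M}

/-- `x` is internal to `M`: there is a club `E` of `[L̂]^ω` in `M` such that every element of
`E ∩ M` captures `x`. -/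
def IsInternal (M : Set ZFSet.{u}) (x : L) : Prop :=
  ∃ E ∈ M, IsClubCountable (completionSet c) E ∧ ∀ Z ∈ E, Z ∈ M → Captures c Z x

/-- The linear order that is realised as a set through `c` is amenable. -/
def IsAmenableVia : Prop :=
  ∀ M ∈ elementarySubmodels c, ∀ x : L, IsInternal c M x

/-- A linear order is amenable if it is amenable for some realisation as a set, that is, if it is
isomorphic to an amenable linearly ordered set. -/
def IsAmenable (L : Type u) [LinearOrder L] : Prop :=
  ∃ c : L ↪ ZFSet.{u}, IsAmenableVia c

end Amenable

end

end LinearOrderBasis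

namespace LinearOrderBasis

/-! ### Club subsets of `ω₁` -/

namespace Omega1

/-! Take a continuous chain of countable elementary submodels `M ξ`, and let `N ξ` be the set of
cuts in `M ξ`. A neighbour of a point `x` at level `ξ` is a nearest element of `N ξ` on the left or
on the right of `x`. Neighbours are unique, and as `ξ` grows their changes do not accumulate at a
level where `x` has a neighbour.

If every point has a neighbour at club many levels, each point is reached after finitely many
changes of neighbour. Naming these neighbours and their sides by natural numbers splits the order
into countably many scattered pieces (`isSigmaScattered_of_isNeighbour`). Hence for stationarily
many `δ` some point `x δ` has no neighbour at level `δ`. Amenability gives a club of countable sets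
in `M δ`, hence in some earlier `M a`, and capturing yields neighbours of `x δ` at all levels in
`[a, δ)`. After pressing down, `Dagger` makes these neighbours lie all on the left, or all on the
right, at levels of a club close to `δ`.

Suppose they lie on the left. The levels at which the neighbour changes form a ladder of type `ω`
cofinal in `δ`. Martin's axiom uniformizes the colorings of ladders by names of neighbours, so that,
after pressing down, ladders that agree up to an index have the same neighbour there. Where two
ladders first differ, the one that jumps earlier belongs to the larger point, and so the points
realise the reverse of the lexicographic order of the ladders (`exists_isBaumgartnerType`). The
right-hand case follows by duality. -/

theorem countable_Iic (a : Omega1) : (Set.Iic a).Countable := by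
  have h : (Set.Iio (Order.succ a.1)).Countable := by
    rw [← Cardinal.le_aleph0_iff_set_countable, Cardinal.mk_Iio_ordinal]
    have h1 : Order.succ a.1 < ω₁ := (Cardinal.isSuccLimit_omega 1).succ_lt a.2
    have h2 : (Order.succ a.1).card < ℵ₁ := by
      rwa [Cardinal.lt_ord.symm, Cardinal.ord_aleph]
    have h3 : (Order.succ a.1).card ≤ ℵ₀ := by
      rwa [← Order.lt_succ_iff, ← Cardinal.succ_aleph0] at *
    rw [Cardinal.lift_le_aleph0]
    exact h3
  refine (h.preimage Subtype.val_injective).mono fun b hb => ?_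
  exact Order.lt_succ_of_le (show b.1 ≤ a.1 from hb)

theorem exists_forall_lt {s : Set Omega1} (hs : s.Countable) : ∃ b, ∀ a ∈ s, a < b := by
  have : Countable s := hs
  have h : ⨆ a : s, Order.succ a.1.1 < ω₁ :=
    Ordinal.iSup_lt_omega_one fun a => (Cardinal.isSuccLimit_omega 1).succ_lt a.1.2
  refine ⟨⟨_, h⟩, fun a ha => ?_⟩
  have h2 := Ordinal.le_iSup (fun a : s => Order.succ a.1.1) ⟨a, ha⟩
  exact Subtype.coe_lt_coe.1 ((Order.lt_succ a.1).trans_le h2)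

instance : NoMaxOrder Omega1 where
  exists_gt a := by
    obtain ⟨b, hb⟩ := exists_forall_lt (Set.countable_singleton a)
    exact ⟨b, hb a rfl⟩

instance : Nonempty Omega1 := ⟨⟨0, Ordinal.omega_pos 1⟩⟩

theorem exists_minimal {s : Set Omega1} (hs : s.Nonempty) : ∃ a ∈ s, ∀ b ∈ s, a ≤ b :=
  ⟨_, wellFounded_lt.min_mem s hs, fun _ hb => wellFounded_lt.min_le hb⟩

theorem exists_lub {s : Set Omega1} (hs : s.Countable) :
    ∃ b, (∀ a ∈ s, a < b) ∧ ∀ c < b, ∃ a ∈ s, c ≤ a := by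
  obtain ⟨b, hb, hb'⟩ := exists_minimal (s := {b | ∀ a ∈ s, a < b}) (exists_forall_lt hs)
  refine ⟨b, hb, fun c hc => ?_⟩
  by_contra! h
  exact hc.not_ge (hb' c h)

theorem isSuccLimit_of {δ a : Omega1} (ha : a < δ) (h : ∀ a < δ, ∃ b, a < b ∧ b < δ) :
    Order.IsSuccLimit δ := by
  refine ⟨fun hm => (hm ha.le).not_gt ha, fun b hb => ?_⟩
  obtain ⟨c, h1, h2⟩ := h b hb.lt
  exact hb.2 h1 h2

theorem _root_.Order.IsSuccLimit.exists_between_omega1 {δ a : Omega1} (hδ : Order.IsSuccLimit δ)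
    (ha : a < δ) : ∃ b, a < b ∧ b < δ :=
  ⟨_, Order.lt_succ a, hδ.succ_lt ha⟩

/-- Non-limit points are isolated in the order topology, so closedness is tested at limits only. -/
theorem isClosed_iff {C : Set Omega1} :
    IsClosed C ↔ ∀ δ, Order.IsSuccLimit δ → (∀ a < δ, ∃ b ∈ C, a < b ∧ b < δ) → δ ∈ C := by
  rw [← isOpen_compl_iff, SuccOrder.isOpen_iff]
  constructor
  · intro h δ hδ hC
    by_contra hn
    obtain ⟨a, ha, hs⟩ := h δ hn hδ
    obtain ⟨b, hb, hab⟩ := hC a ha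
    exact hs hab hb
  · intro h δ hn hδ
    by_contra! hC
    refine hn (h δ hδ fun a ha => ?_)
    obtain ⟨b, hb, hb'⟩ := Set.not_subset.1 (hC a ha)
    exact ⟨b, not_not.1 hb', hb⟩

end Omega1

theorem isClub_closurePoints (h : Omega1 → Omega1) :
    IsClub {δ | Order.IsSuccLimit δ ∧ ∀ ξ < δ, h ξ < δ} := by
  refine ⟨Omega1.isClosed_iff.2 fun δ hδ hC => ⟨hδ, fun ξ hξ => ?_⟩, fun α => ?_⟩
  · obtain ⟨b, hb, h1, h2⟩ := hC ξ hξ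
    exact (hb.2 ξ h1).trans h2
  · have hg : ∀ a : Omega1, ∃ b, a < b ∧ ∀ ξ ≤ a, h ξ < b := fun a => by
      obtain ⟨b, hb⟩ := Omega1.exists_forall_lt
        ((((Omega1.countable_Iic a).image h).union (Set.countable_singleton a)))
      exact ⟨b, hb a (Or.inr rfl), fun ξ hξ => hb _ (Or.inl ⟨ξ, hξ, rfl⟩)⟩
    choose g hg1 hg2 using hg
    -- Each `ξ` below the supremum of the iterates lies under one of them, and the following iterate
    -- bounds `h ξ`.
    obtain ⟨δ, h1, h2⟩ := Omega1.exists_lub (Set.countable_range fun n : ℕ => g^[n] α)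
    have h1' : ∀ n : ℕ, g^[n] α < δ := fun n => h1 _ ⟨n, rfl⟩
    have h3 : ∀ ξ < δ, ∃ n : ℕ, ξ ≤ g^[n] α := fun ξ hξ => by
      obtain ⟨_, ⟨n, rfl⟩, h⟩ := h2 ξ hξ
      exact ⟨n, h⟩
    refine ⟨δ, ⟨Omega1.isSuccLimit_of (h1' 0) fun ξ hξ => ?_, fun ξ hξ => ?_⟩, (h1' 0).le⟩ <;>
    obtain ⟨n, hn⟩ := h3 ξ hξ <;> have h4 := h1' (n + 1) <;>
    rw [Function.iterate_succ_apply'] at h4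
    · exact ⟨_, hn.trans_lt (hg1 _), h4⟩
    · exact (hg2 _ _ hn).trans h4

/-- A diagonal intersection: if `δ` is closed under a bound for the next elements of the countably
many clubs met up to each stage, it is a limit of all of them. -/
theorem exists_isClub_forall_mem {X : Type*} (C : X → Set Omega1) (Q : Omega1 → Set X)
    (hQ : ∀ ξ, (Q ξ).Countable) (hC : ∀ v, IsClub (C v)) :
    ∃ D, IsClub D ∧ ∀ δ ∈ D, Order.IsSuccLimit δ ∧ ∀ ξ < δ, ∀ v ∈ Q ξ, δ ∈ C v := by
  have hn : ∀ v a, ∃ b ∈ C v, a < b := fun v a => by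
    obtain ⟨a', ha'⟩ := exists_gt a
    obtain ⟨b, hb, h⟩ := (hC v).2 a'
    exact ⟨b, hb, ha'.trans_le h⟩
  choose next hn1 hn2 using hn
  have hh : ∀ a : Omega1, ∃ b, ∀ ξ ≤ a, ∀ v ∈ Q ξ, next v a < b := fun a => by
    obtain ⟨b, hb⟩ := Omega1.exists_forall_lt
      (((Omega1.countable_Iic a).biUnion fun ξ _ => hQ ξ).image fun v => next v a)
    exact ⟨b, fun ξ hξ v hv => hb _ ⟨v, Set.mem_biUnion hξ hv, rfl⟩⟩
  choose h hh using hh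
  refine ⟨_, isClub_closurePoints h, fun δ hδ => ⟨hδ.1, fun ξ hξ v hv => ?_⟩⟩
  refine Omega1.isClosed_iff.1 (hC v).1 δ hδ.1 fun a ha => ?_
  have hm : max a ξ < δ := max_lt ha hξ
  exact ⟨next v (max a ξ), hn1 _ _, (le_max_left _ _).trans_lt (hn2 _ _),
    (hh _ ξ (le_max_right _ _) v hv).trans (hδ.2 _ hm)⟩

/-! ### Stationary subsets of `ω₁` -/

theorem IsStationary.mono {S T : Set Omega1} (hS : IsStationary S) (h : S ⊆ T) : IsStationary T :=
  fun C hC => (hS C hC).mono (Set.inter_subset_inter_left _ h)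

theorem IsStationary.inter_isClub {S C : Set Omega1} (hS : IsStationary S) (hC : IsClub C) :
    IsStationary (S ∩ C) := by
  intro C' hC'
  obtain ⟨D, hD, h⟩ := exists_isClub_forall_mem (fun b : Bool => if b then C else C')
    (fun _ => Set.univ) (fun _ => Set.to_countable _) (by intro b; cases b <;> simpa)
  obtain ⟨δ, hδS, hδD⟩ := hS D hD
  obtain ⟨h1, h2⟩ := h δ hδD
  obtain ⟨ξ, hξ⟩ := h1.nonempty_Iio
  have ht := h2 ξ hξ true trivial
  have hf := h2 ξ hξ false trivial
  exact ⟨δ, ⟨hδS, by simpa using ht⟩, by simpa using hf⟩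

theorem isClub_isSuccLimit : IsClub {δ : Omega1 | Order.IsSuccLimit δ} := by
  refine ⟨Omega1.isClosed_iff.2 fun δ hδ _ => hδ, fun a => ?_⟩
  obtain ⟨b, hb, h⟩ := (isClub_closurePoints id).2 a
  exact ⟨b, hb.1, h⟩

theorem isClub_Ioi (a : Omega1) : IsClub (Set.Ioi a) := by
  refine ⟨Omega1.isClosed_iff.2 fun δ hδ h => ?_, fun b => ?_⟩
  · obtain ⟨c, hc⟩ := hδ.nonempty_Iio
    obtain ⟨b, hb, -, hbδ⟩ := h c hc
    exact (Set.mem_Ioi.1 hb).trans hbδ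
  · obtain ⟨c, hc⟩ := exists_gt (max a b)
    exact ⟨c, (le_max_left _ _).trans_lt hc, ((le_max_right _ _).trans_lt hc).le⟩

/-- The limit points of a club form a club. -/
theorem IsClub.limitPoints {E : Set Omega1} (hE : IsClub E) :
    IsClub {δ | Order.IsSuccLimit δ ∧ ∀ a < δ, ∃ b ∈ E, a < b ∧ b < δ} := by
  refine ⟨Omega1.isClosed_iff.2 fun δ hδ h => ⟨hδ, fun a ha => ?_⟩, fun α => ?_⟩
  · obtain ⟨b, hb, h1, h2⟩ := h a ha
    obtain ⟨c, hc, h3, h4⟩ := hb.2 a h1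
    exact ⟨c, hc, h3, h4.trans h2⟩
  · have hn : ∀ a, ∃ b ∈ E, a < b := fun a => by
      obtain ⟨a', ha'⟩ := exists_gt a
      obtain ⟨b, hb, h⟩ := hE.2 a'
      exact ⟨b, hb, ha'.trans_le h⟩
    choose g hg1 hg2 using hn
    obtain ⟨δ, hδ, h⟩ := (isClub_closurePoints g).2 α
    exact ⟨δ, ⟨hδ.1, fun a ha => ⟨g a, hg1 a, hg2 a, hδ.2 a ha⟩⟩, h⟩

/-- The pressing down lemma, for functions with values in an increasing union of countable sets. -/
theorem IsStationary.exists_const {X : Type*} {S : Set Omega1} (hS : IsStationary S)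
    (F : Omega1 → X) (Q : Omega1 → Set X) (hQ : ∀ ξ, (Q ξ).Countable)
    (hF : ∀ δ ∈ S, ∃ ξ < δ, F δ ∈ Q ξ) : ∃ v, IsStationary {δ ∈ S | F δ = v} := by
  by_contra! h
  have h' : ∀ v, ∃ C, IsClub C ∧ ¬ ({δ ∈ S | F δ = v} ∩ C).Nonempty := fun v => by
    have := h v
    unfold IsStationary at this
    push Not at this
    obtain ⟨C, hC, h⟩ := this
    exact ⟨C, hC, by rw [h]; simp⟩
  choose C hC hCe using h'
  -- A point of `S` in the diagonal intersection would lie in the club that avoids its own fibre.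
  obtain ⟨D, hD, hD'⟩ := exists_isClub_forall_mem C Q hQ hC
  obtain ⟨δ, hδ, hδD⟩ := hS D hD
  obtain ⟨ξ, hξ, hq⟩ := hF δ hδ
  exact hCe (F δ) ⟨δ, ⟨hδ, rfl⟩, (hD' δ hδD).2 ξ hξ _ hq⟩

/-! ### Restricting an increasing sequence of sets to a club -/

/-- The least element of `E` that is at least `ξ`. -/
noncomputable def IsClub.next {E : Set Omega1} (hE : IsClub E) (ξ : Omega1) : Omega1 :=
  wellFounded_lt.min {b | b ∈ E ∧ ξ ≤ b} (hE.2 ξ)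

theorem IsClub.next_mem {E : Set Omega1} (hE : IsClub E) (ξ : Omega1) : hE.next ξ ∈ E :=
  (wellFounded_lt.min_mem {b | b ∈ E ∧ ξ ≤ b} (hE.2 ξ)).1

theorem IsClub.le_next {E : Set Omega1} (hE : IsClub E) (ξ : Omega1) : ξ ≤ hE.next ξ :=
  (wellFounded_lt.min_mem {b | b ∈ E ∧ ξ ≤ b} (hE.2 ξ)).2

theorem IsClub.next_le {E : Set Omega1} (hE : IsClub E) {ξ b : Omega1} (hb : b ∈ E)
    (h : ξ ≤ b) : hE.next ξ ≤ b :=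
  wellFounded_lt.min_le (s := {b | b ∈ E ∧ ξ ≤ b}) ⟨hb, h⟩

theorem IsClub.next_eq {E : Set Omega1} (hE : IsClub E) {ξ : Omega1} (hξ : ξ ∈ E) :
    hE.next ξ = ξ :=
  (hE.next_le hξ le_rfl).antisymm (hE.le_next ξ)

theorem IsClub.next_mono {E : Set Omega1} (hE : IsClub E) : Monotone hE.next := fun _ b h =>
  hE.next_le (hE.next_mem b) (h.trans (hE.le_next b))

/-- An increasing continuous sequence of countable sets. -/
structure IsFiltration {W : Type*} (N : Omega1 → Set W) : Prop where
  mono : Monotone N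
  countable : ∀ ξ, (N ξ).Countable
  exists_lt : ∀ {ξ}, Order.IsSuccLimit ξ → ∀ {w}, w ∈ N ξ → ∃ η < ξ, w ∈ N η

/-- At a limit `ξ`, either `ξ` is a limit of `E` and is its own next element, or `next` is constant
on an interval ending at `ξ`. -/
theorem IsFiltration.comp_next {W : Type*} {N : Omega1 → Set W} (hN : IsFiltration N)
    {E : Set Omega1} (hE : IsClub E) : IsFiltration fun ξ => N (hE.next ξ) where
  mono := hN.mono.comp hE.next_mono
  countable _ := hN.countable _
  exists_lt := by
    intro ξ hξ w hw
    by_cases h : ∀ a < ξ, ∃ b ∈ E, a < b ∧ b < ξ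
    · rw [hE.next_eq (Omega1.isClosed_iff.1 hE.1 ξ hξ h)] at hw
      obtain ⟨η, hη, hw⟩ := hN.exists_lt hξ hw
      exact ⟨η, hη, hN.mono (hE.le_next η) hw⟩
    · push Not at h
      obtain ⟨a, ha, h⟩ := h
      obtain ⟨b, hab, hb⟩ := hξ.exists_between_omega1 ha
      refine ⟨b, hb, hN.mono (hE.next_le (hE.next_mem b) ?_) hw⟩
      exact h _ (hE.next_mem b) (hab.trans_le (hE.le_next b))

/-! ### Uniformization of ladder system colorings -/

/-- Martin's axiom for partial orders of arbitrary universe level. -/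
theorem MartinsAxiomOmega1.of_small (hMA : MartinsAxiomOmega1.{u}) {P : Type v} [PartialOrder P]
    [Nonempty P] [Small.{u} P] (hP : CCC P) (D : Omega1 → Set P)
    (hD : ∀ ξ p, ∃ q ∈ D ξ, q ≤ p) :
    ∃ G : Set P, (∀ p ∈ G, ∀ q ∈ G, ∃ r ∈ G, r ≤ p ∧ r ≤ q) ∧ ∀ ξ, ∃ p ∈ G, p ∈ D ξ := by
  let e : Shrink.{u} P ≃ P := (equivShrink P).symm
  let _ : PartialOrder (Shrink.{u} P) := PartialOrder.lift e e.injective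
  have : Nonempty (Shrink.{u} P) := ⟨e.symm (Classical.arbitrary P)⟩
  have hle : ∀ a b : Shrink.{u} P, a ≤ b ↔ e a ≤ e b := fun _ _ => Iff.rfl
  have hccc : CCC (Shrink.{u} P) := fun A hA => by
    have h := hP (e '' A) ?_
    · exact (Set.countable_of_injective_of_countable_image e.injective.injOn h)
    · rintro _ ⟨p, hp, rfl⟩ _ ⟨q, hq, rfl⟩ hpq ⟨r, h1, h2⟩
      refine hA p hp q hq (fun h => hpq (h ▸ rfl)) ⟨e.symm r, ?_, ?_⟩ <;> simpa [hle]
  obtain ⟨G, hG⟩ := hMA (Shrink.{u} P) hccc (fun ξ => e ⁻¹' D ξ) fun ξ p => by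
    obtain ⟨q, hq, hqp⟩ := hD ξ (e p)
    exact ⟨e.symm q, by simpa using hq, by simpa [hle] using hqp⟩
  refine ⟨e '' {p | p ∈ G}, ?_, fun ξ => ?_⟩
  · rintro _ ⟨p, hp, rfl⟩ _ ⟨q, hq, rfl⟩
    obtain ⟨r, hr, h1, h2⟩ := G.directed p hp q hq
    exact ⟨e r, ⟨r, hr, rfl⟩, h1, h2⟩
  · obtain ⟨p, hp, h⟩ := hG ξ
    exact ⟨e p, ⟨p, hp, rfl⟩, h⟩

/-- `lad` is a ladder system on `S`. -/
def IsLadderSystem (S : Set Omega1) (lad : Omega1 → ℕ → Omega1) : Prop :=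
  ∀ α ∈ S, StrictMono (lad α) ∧ (∀ n, lad α n < α) ∧ ∀ β < α, ∃ n, β < lad α n

theorem IsLadderSystem.finite_lt {S : Set Omega1} {lad : Omega1 → ℕ → Omega1}
    (h : IsLadderSystem S lad) {α β : Omega1} (hα : α ∈ S) (hβ : β < α) :
    {n | lad α n ≤ β}.Finite := by
  obtain ⟨n, hn⟩ := (h α hα).2.2 β hβ
  refine (Set.finite_Iio n).subset fun m hm => ?_
  exact (h α hα).1.lt_iff_lt.1 (lt_of_le_of_lt hm hn)

/-- The promises `(δ, n)` in `u`, saying that the coloring of the ladder at `δ` is followed from the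
index `n` on, are compatible with each other. -/
def IsCoherent (lad : Omega1 → ℕ → Omega1) (c : Omega1 → ℕ → ℕ) (u : Set (Omega1 × ℕ)) : Prop :=
  ∀ p ∈ u, ∀ q ∈ u, ∀ m k, p.2 ≤ m → q.2 ≤ k → lad p.1 m = lad q.1 k → c p.1 m = c q.1 k

/-- A maximal root of an uncountable family of finite sets of bounded size. -/
theorem exists_maximal_root {X : Type*} {A : Set (Finset X)} (hA : ¬ A.Countable) (k : ℕ)
    (hk : ∀ u ∈ A, u.card = k) :
    ∃ r : Finset X, ¬ {u ∈ A | r ⊆ u}.Countable ∧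
      ∀ p ∉ r, {u ∈ A | r ⊆ u ∧ p ∈ u}.Countable := by
  classical
  by_contra! h
  -- Without a maximal root, roots could be enlarged indefinitely while keeping uncountably many
  -- supersets in `A`; a root of size `k + 1` has none.
  have key : ∀ j : ℕ, ∃ r : Finset X, r.card = j ∧ ¬ {u ∈ A | r ⊆ u}.Countable := by
    intro j
    induction j with
    | zero => exact ⟨∅, rfl, by simpa using hA⟩
    | succ j ih =>
      obtain ⟨r, hr, hu⟩ := ih
      obtain ⟨p, hp, hup⟩ := h r hu
      refine ⟨insert p r, by rw [Finset.card_insert_of_notMem hp, hr], fun hc => hup ?_⟩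
      refine Set.Countable.mono (fun u hu => ?_) hc
      exact ⟨hu.1, Finset.insert_subset hu.2.2 hu.2.1⟩
  obtain ⟨r, hr, hu⟩ := key (k + 1)
  refine hu ?_
  convert Set.countable_empty
  ext u
  simp only [Set.mem_ofPred_eq, Set.mem_empty_iff_false, iff_false, not_and]
  intro hu hru
  have := Finset.card_le_card hru
  rw [hk u hu] at this
  omega

/-- An uncountable family of finite coherent sets of promises has two members whose union is
coherent. -/
theorem exists_coherent_union {S : Set Omega1} {lad : Omega1 → ℕ → Omega1}
    (hlad : IsLadderSystem S lad) (c : Omega1 → ℕ → ℕ) {A : Set (Finset (Omega1 × ℕ))}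
    (hA : ¬ A.Countable) (hS : ∀ u ∈ A, ∀ p ∈ u, p.1 ∈ S)
    (hc : ∀ u ∈ A, IsCoherent lad c (u : Set (Omega1 × ℕ))) :
    ∃ u ∈ A, ∃ v ∈ A, u ≠ v ∧ IsCoherent lad c ((u : Set (Omega1 × ℕ)) ∪ v) := by
  obtain ⟨k, hk⟩ : ∃ k, ¬ {u ∈ A | u.card = k}.Countable := by
    by_contra! h
    refine hA ((Set.countable_iUnion h).mono fun u hu => ?_)
    exact Set.mem_iUnion.2 ⟨u.card, hu, rfl⟩
  obtain ⟨r, hr, hmax⟩ := exists_maximal_root hk k fun u hu => hu.2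
  -- By maximality of `r`, only countably many members contain a promise outside `r` at a point up
  -- to `α`; any other member extending `r` properly will do.
  have hex : ∀ α : Omega1, ∃ u ∈ A, r ⊆ u ∧ u ≠ r ∧ ∀ p ∈ u, p ∉ r → α < p.1 := by
    intro α
    have hP : {p : Omega1 × ℕ | p.1 ≤ α ∧ p ∉ r}.Countable := by
      refine Set.Countable.mono (fun p hp => ?_)
        ((Omega1.countable_Iic α).prod (Set.countable_univ (α := ℕ)))
      exact ⟨hp.1, trivial⟩
    have hcount := ((hP.biUnion fun p hp => hmax p hp.2).union (Set.countable_singleton r))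
    obtain ⟨u, hu, hu'⟩ := Set.not_subset.1 fun h => hr (hcount.mono h)
    refine ⟨u, hu.1.1, hu.2, fun h => hu' (Or.inr h), fun p hp hpr => ?_⟩
    by_contra hlt
    exact hu' (Or.inl (Set.mem_biUnion (x := p) ⟨not_lt.1 hlt, hpr⟩ ⟨hu.1, hu.2, hp⟩))
  choose w hwA hrw hwr hw using hex
  -- The colors that the new promises of `w α` prescribe below `α`. There are finitely many, since a
  -- ladder at a point above `α` has finitely many terms up to `α`; so pressing down can make `t`
  -- constant.
  let t : Omega1 → Set (Omega1 × ℕ) := fun α =>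
    {x | x.1 < α ∧ ∃ p ∈ w α, p ∉ r ∧ ∃ m, p.2 ≤ m ∧ x = (lad p.1 m, c p.1 m)}
  have htfin : ∀ α, (t α).Finite := by
    intro α
    have : t α ⊆ ⋃ p ∈ {p | p ∈ w α ∧ p ∉ r},
        (fun m => (lad p.1 m, c p.1 m)) '' {m | lad p.1 m ≤ α} := by
      rintro x ⟨hx, p, hp, hpr, m, -, rfl⟩
      exact Set.mem_biUnion (x := p) ⟨hp, hpr⟩ ⟨m, hx.le, rfl⟩
    refine Set.Finite.subset (Set.Finite.biUnion ?_ fun p hp => ?_) this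
    · exact (w α).finite_toSet.subset fun p hp => hp.1
    · exact (hlad.finite_lt (hS _ (hwA α) p hp.1) (hw α p hp.1 hp.2)).image _
  have hlim : IsStationary {δ : Omega1 | Order.IsSuccLimit δ} := by
    have h : IsStationary (Set.univ : Set Omega1) := fun C hC => by
      obtain ⟨b, hb, -⟩ := hC.2 (Classical.arbitrary _)
      exact ⟨b, trivial, hb⟩
    simpa using h.inter_isClub isClub_isSuccLimit
  obtain ⟨T, hT⟩ := hlim.exists_const t
    (fun ξ => {s | s.Finite ∧ s ⊆ Set.Iic ξ ×ˢ Set.univ})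
    (fun ξ => Set.countable_ofPred_finite_subset
      ((Omega1.countable_Iic ξ).prod Set.countable_univ)) (by
    intro δ hδ
    have hfin := htfin δ
    obtain ⟨a, ha⟩ := Order.IsSuccLimit.nonempty_Iio hδ
    obtain ⟨b, hb, hb'⟩ := Set.exists_max_image (insert a (Prod.fst '' t δ)) id
      ((hfin.image _).insert a) (Set.insert_nonempty _ _)
    refine ⟨b, ?_, hfin, fun x hx => ⟨hb' _ (Or.inr ⟨x, hx, rfl⟩), trivial⟩⟩
    rcases hb with rfl | ⟨x, hx, rfl⟩
    · exact ha
    · exact hx.1)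
  obtain ⟨α, hα⟩ := hT _ (isClub_Ioi (Classical.arbitrary _))
  obtain ⟨b, hb⟩ := Omega1.exists_forall_lt
    (((w α).finite_toSet.image Prod.fst).countable)
  obtain ⟨β, hβ, hbβ⟩ := hT _ (isClub_Ioi b)
  have hdom : ∀ p ∈ w α, p.1 < β := fun p hp => (hb _ ⟨p, hp, rfl⟩).trans hbβ
  -- A shared ladder point lies below `β`, so its color under `w β` is recorded in `t β = t α` and
  -- is also prescribed by `w α`, which is coherent.
  have hcross : ∀ p ∈ w α, p ∉ r → ∀ q ∈ w β, q ∉ r → ∀ m k, p.2 ≤ m → q.2 ≤ k →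
      lad p.1 m = lad q.1 k → c p.1 m = c q.1 k := by
    intro p hp hpr q hq hqr m k hm hk h
    have hlt : lad q.1 k < β :=
      h ▸ ((hlad _ (hS _ (hwA α) p hp)).2.1 m).trans (hdom p hp)
    have hmem : (lad q.1 k, c q.1 k) ∈ t β := ⟨hlt, q, hq, hqr, k, hk, rfl⟩
    rw [hβ.2, ← hα.1.2] at hmem
    obtain ⟨-, q', hq', -, k', hk', he⟩ := hmem
    rw [Prod.mk.injEq] at he
    rw [he.2]
    exact hc _ (hwA α) p hp q' hq' m k' hm hk' (h.trans he.1)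
  refine ⟨w α, hwA α, w β, hwA β, fun he => ?_, ?_⟩
  · obtain ⟨p, hp, hpr⟩ := Finset.exists_of_ssubset ((hrw β).ssubset_of_ne (hwr β).symm)
    exact (hw β p hp hpr).not_gt (hdom p (he ▸ hp))
  · have hcα := hc _ (hwA α)
    have hcβ := hc _ (hwA β)
    rintro p (hp | hp) q (hq | hq) m k hm hk h
    · exact hcα p hp q hq m k hm hk h
    · by_cases hpr : p ∈ r
      · exact hcβ p (hrw β hpr) q hq m k hm hk h
      · by_cases hqr : q ∈ r
        · exact hcα p hp q (hrw α hqr) m k hm hk h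
        · exact hcross p hp hpr q hq hqr m k hm hk h
    · by_cases hpr : p ∈ r
      · exact hcα p (hrw α hpr) q hq m k hm hk h
      · by_cases hqr : q ∈ r
        · exact hcβ p hp q (hrw β hqr) m k hm hk h
        · exact (hcross q hq hqr p hp hpr k m hk hm h.symm).symm
    · exact hcβ p hp q hq m k hm hk h

/-- Two different ladders are almost disjoint. -/
theorem IsLadderSystem.exists_disjoint {S : Set Omega1} {lad : Omega1 → ℕ → Omega1}
    (hlad : IsLadderSystem S lad) {α β : Omega1} (hα : α ∈ S) (hβ : β ∈ S) (h : α ≠ β) :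
    ∃ n, ∀ m ≥ n, ∀ k, lad α m ≠ lad β k := by
  rcases h.lt_or_gt with h | h
  · have hfin := ((hlad.finite_lt hβ h).image (lad β)).preimage
      (f := lad α) (hlad α hα).1.injective.injOn
    obtain ⟨n, hn⟩ := hfin.bddAbove
    refine ⟨n + 1, fun m hm k he => ?_⟩
    have := hn (a := m) ⟨k, (he.symm.trans_lt ((hlad α hα).2.1 m)).le, he.symm⟩
    omega
  · obtain ⟨n, hn⟩ := (hlad.finite_lt hα h).bddAbove
    refine ⟨n + 1, fun m hm k he => ?_⟩
    have := hn (a := m) (he.trans_lt ((hlad β hβ).2.1 k)).le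
    omega

/-- Under `MA_{ω₁}`, every coloring of a ladder system can be uniformized. -/
theorem MartinsAxiomOmega1.uniformize (hMA : MartinsAxiomOmega1.{u}) {S : Set Omega1}
    {lad : Omega1 → ℕ → Omega1} (hlad : IsLadderSystem S lad) (c : Omega1 → ℕ → ℕ) :
    ∃ f : Omega1 → ℕ, ∀ δ ∈ S, ∃ n, ∀ m ≥ n, f (lad δ m) = c δ m := by
  classical
  let P := {u : Finset (Omega1 × ℕ) // (∀ p ∈ u, p.1 ∈ S) ∧
    IsCoherent lad c (u : Set (Omega1 × ℕ))}
  have : Small.{u} (Finset (Omega1 × ℕ)) := by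
    let e : Omega1 × ℕ ↪ ULift.{u} (Shrink.{0} Omega1) × ℕ :=
      ((equivShrink Omega1).trans Equiv.ulift.symm).toEmbedding.prodMap (.refl ℕ)
    exact small_of_injective (Finset.map_injective e)
  have : Small.{u} Pᵒᵈ := small_subtype.{u} _ _
  have : Nonempty Pᵒᵈ := ⟨OrderDual.toDual ⟨∅, by simp, by simp [IsCoherent]⟩⟩
  have hle : ∀ a b : Pᵒᵈ, a ≤ b ↔ (OrderDual.ofDual b).1 ⊆ (OrderDual.ofDual a).1 :=
    fun _ _ => Iff.rfl
  have hccc : CCC Pᵒᵈ := by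
    intro A hA
    by_contra hunc
    let j : Pᵒᵈ → Finset (Omega1 × ℕ) := fun a => (OrderDual.ofDual a).1
    have hj : Function.Injective j := fun a b h => Subtype.ext h
    obtain ⟨_, ⟨u, hu, rfl⟩, _, ⟨v, hv, rfl⟩, hne, hcoh⟩ :=
      exists_coherent_union hlad c (A := j '' A)
        (fun h => hunc (Set.countable_of_injective_of_countable_image hj.injOn h))
        (by rintro _ ⟨u, -, rfl⟩; exact u.2.1) (by rintro _ ⟨u, -, rfl⟩; exact u.2.2)
    refine hA u hu v hv (fun h => hne (h ▸ rfl)) ⟨OrderDual.toDual ⟨j u ∪ j v, ?_, ?_⟩, ?_, ?_⟩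
    · intro p hp
      rcases Finset.mem_union.1 hp with hp | hp
      · exact u.2.1 p hp
      · exact v.2.1 p hp
    · simpa using hcoh
    · exact Finset.subset_union_left
    · exact Finset.subset_union_right
  obtain ⟨G, hdir, hG⟩ := hMA.of_small hccc
    (fun δ => {u | δ ∈ S → ∃ n, (δ, n) ∈ (OrderDual.ofDual u).1}) (by
    intro δ u
    by_cases hδ : δ ∈ S
    swap
    · exact ⟨u, fun h => absurd h hδ, le_rfl⟩
    by_cases hu : ∃ n, (δ, n) ∈ (OrderDual.ofDual u).1
    · exact ⟨u, fun _ => hu, le_rfl⟩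
    -- The new promise starts beyond the finite overlaps with the ladders already promised, so it
    -- cannot conflict with them.
    have hdisj : ∀ p : Omega1 × ℕ, ∃ n, p ∈ (OrderDual.ofDual u).1 →
        ∀ m ≥ n, ∀ k, lad δ m ≠ lad p.1 k := fun p => by
      by_cases hp : p ∈ (OrderDual.ofDual u).1
      · have hpδ : δ ≠ p.1 := fun h => hu ⟨p.2, by rw [h]; exact hp⟩
        obtain ⟨n, hn⟩ := hlad.exists_disjoint hδ ((OrderDual.ofDual u).2.1 p hp) hpδ
        exact ⟨n, fun _ => hn⟩
      · exact ⟨0, fun h => absurd h hp⟩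
    choose g hg using hdisj
    let N := (OrderDual.ofDual u).1.sup g
    have hN : ∀ p ∈ (OrderDual.ofDual u).1, ∀ m ≥ N, ∀ k, lad δ m ≠ lad p.1 k :=
      fun p hp m hm => hg p hp m ((Finset.le_sup hp).trans hm)
    refine ⟨OrderDual.toDual ⟨insert (δ, N) (OrderDual.ofDual u).1, ?_, ?_⟩,
      fun _ => ⟨N, Finset.mem_insert_self _ _⟩, Finset.subset_insert _ _⟩
    · intro p hp
      rcases Finset.mem_insert.1 hp with rfl | hp
      · exact hδ
      · exact (OrderDual.ofDual u).2.1 p hp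
    · intro p hp q hq m k hm hk h
      rcases Finset.mem_insert.1 hp with rfl | hp <;> rcases Finset.mem_insert.1 hq with rfl | hq
      · rw [(hlad δ hδ).1.injective h]
      · exact absurd h (hN q hq m hm k)
      · exact absurd h.symm (hN p hp k hk m)
      · exact (OrderDual.ofDual u).2.2 p hp q hq m k hm hk h)
  let R : Omega1 → ℕ → Prop := fun ξ v =>
    ∃ u ∈ G, ∃ p ∈ (OrderDual.ofDual u).1, ∃ m ≥ p.2, lad p.1 m = ξ ∧ c p.1 m = v
  refine ⟨fun ξ => if h : ∃ v, R ξ v then h.choose else 0, fun δ hδ => ?_⟩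
  obtain ⟨u, hu, hu'⟩ := hG δ
  obtain ⟨n, hn⟩ := hu' hδ
  refine ⟨n, fun m hm => ?_⟩
  have h : ∃ v, R (lad δ m) v := ⟨c δ m, u, hu, (δ, n), hn, m, hm, rfl, rfl⟩
  simp only [h, dif_pos]
  obtain ⟨u', hu', p, hp, k, hk, h1, h2⟩ := h.choose_spec
  -- The chosen value may come from another condition in `G`; coherence of a common extension makes
  -- the two colors equal.
  obtain ⟨r, -, hr1, hr2⟩ := hdir u hu u' hu'
  rw [← h2]
  exact (OrderDual.ofDual r).2.2 p (hr2 hp) (δ, n) (hr1 hn) k m hk hm h1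

/-! ### The jumps of a function on `ω₁` -/

section Jump

variable {W : Type*}

open Classical in
/-- The least point after `ξ` at which `z` takes another value than at `ξ`, if there is one. -/
noncomputable def nextJump (z : Omega1 → W) (ξ : Omega1) : Omega1 :=
  if h : ∃ η, ξ < η ∧ z η ≠ z ξ then wellFounded_lt.min {η | ξ < η ∧ z η ≠ z ξ} h else ξ

/-- The successive jumps of `z`, from `a` on. -/
noncomputable def jump (z : Omega1 → W) (a : Omega1) : ℕ → Omega1
  | 0 => a
  | n + 1 => nextJump z (jump z a n)

theorem nextJump_spec {z : Omega1 → W} {ξ : Omega1} (h : ∃ η, ξ < η ∧ z η ≠ z ξ) :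
    ξ < nextJump z ξ ∧ z (nextJump z ξ) ≠ z ξ := by
  rw [nextJump, dif_pos h]
  exact wellFounded_lt.min_mem {η | ξ < η ∧ z η ≠ z ξ} h

theorem nextJump_le {z : Omega1 → W} {ξ η : Omega1} (h : ξ < η) (hz : z η ≠ z ξ) :
    nextJump z ξ ≤ η := by
  rw [nextJump, dif_pos ⟨η, h, hz⟩]
  exact wellFounded_lt.min_le (s := {η | ξ < η ∧ z η ≠ z ξ}) ⟨h, hz⟩

theorem eq_of_lt_nextJump {z : Omega1 → W} {ξ η : Omega1} (h : ξ ≤ η) (hη : η < nextJump z ξ) :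
    z η = z ξ := by
  by_contra hz
  exact hη.not_ge (nextJump_le (h.lt_of_ne fun he => hz (by rw [he])) hz)

/-- If the jumps stayed bounded below `δ`, their supremum would be a limit with `z` constant just
below it, although jumps occur there. -/
theorem exists_lt_jump {z : Omega1 → W} {a δ : Omega1}
    (hj : ∀ n, jump z a n < jump z a (n + 1) ∧ z (jump z a (n + 1)) ≠ z (jump z a n))
    (hz : ∀ η, Order.IsSuccLimit η → a < η → η < δ → ∃ b < η, ∀ ζ, b ≤ ζ → ζ < η → z ζ = z η) :
    ∀ β < δ, ∃ n, β < jump z a n := by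
  intro β hβ
  by_contra! h
  obtain ⟨η, h1, h2⟩ := Omega1.exists_lub (Set.countable_range (jump z a))
  have h1' : ∀ n, jump z a n < η := fun n => h1 _ ⟨n, rfl⟩
  have h2' : ∀ c < η, ∃ n, c ≤ jump z a n := fun c hc => by
    obtain ⟨_, ⟨n, rfl⟩, h⟩ := h2 c hc
    exact ⟨n, h⟩
  have hηβ : η ≤ β := by
    by_contra! hlt
    obtain ⟨n, hn⟩ := h2' β hlt
    exact ((hj n).1.trans_le (h (n + 1))).not_ge hn
  have hlim : Order.IsSuccLimit η := Omega1.isSuccLimit_of (h1' 0) fun c hc => by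
    obtain ⟨n, hn⟩ := h2' c hc
    exact ⟨_, hn.trans_lt (hj n).1, h1' _⟩
  obtain ⟨b, hb, hconst⟩ := hz η hlim (h1' 0) (hηβ.trans_lt hβ)
  obtain ⟨n, hn⟩ := h2' b hb
  refine (hj n).2 ?_
  rw [hconst _ hn (h1' n), hconst _ (hn.trans (hj n).1.le) (h1' _)]

end Jump

/-! ### Finding a Baumgartner type -/

section Core

variable {W : Type*} [LinearOrder W]

/-- If `z` bounds `y` but not `x` from below as seen by `A`, then `y < x`. -/
theorem lt_of_isGreatest {A : Set W} {x y z : W} (hy : IsGreatest (A ∩ Set.Iic y) z) (hz : z ≤ x)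
    (hx : ¬ IsGreatest (A ∩ Set.Iic x) z) : y < x := by
  by_contra! h
  exact hx ⟨⟨hy.1.1, hz⟩, fun w hw => hy.2 ⟨hw.1, le_trans hw.2 h⟩⟩

theorem isGreatest_inter_of_subset {A B : Set W} {x z : W} (hB : IsGreatest (B ∩ Set.Iic x) z)
    (h : A ⊆ B) (hz : z ∈ A) : IsGreatest (A ∩ Set.Iic x) z :=
  ⟨⟨hz, hB.1.2⟩, fun _ hw => hB.2 ⟨h hw.1, hw.2⟩⟩

theorem countable_lists {X : Type*} {s : Set X} (hs : s.Countable) :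
    {l : List X | ∀ x ∈ l, x ∈ s}.Countable := by
  have : Countable s := hs
  rw [← Set.range_list_map_coe]
  exact Set.countable_range _

/-- If stationarily many points are approximated from below by the greatest element on their left
at all earlier levels of a filtration, but not at the present level, then there is a copy of the
reverse of a Baumgartner type. -/
theorem exists_isBaumgartnerType (hMA : MartinsAxiomOmega1.{u}) {L : Type v} [LinearOrder L]
    (i : L ↪o W) {N : Omega1 → Set W} (hN : IsFiltration N) {S : Set Omega1}
    (hS : IsStationary S) (x : Omega1 → L) (a : Omega1)
    (hx : ∀ δ ∈ S, ∀ ξ, a < ξ → ξ < δ → ∃ z, IsGreatest (N ξ ∩ Set.Iic (i (x δ))) z)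
    (hx' : ∀ δ ∈ S, ¬ ∃ z, IsGreatest (N δ ∩ Set.Iic (i (x δ))) z) :
    ∃ B : Set (Lex (ℕ → Omega1)), IsBaumgartnerType B ∧ Nonempty ((B : Type 1)ᵒᵈ ↪o L) := by
  have hz : ∀ δ ξ, ∃ z, (∃ z, IsGreatest (N ξ ∩ Set.Iic (i (x δ))) z) →
      IsGreatest (N ξ ∩ Set.Iic (i (x δ))) z := fun δ ξ => by
    by_cases h : ∃ z, IsGreatest (N ξ ∩ Set.Iic (i (x δ))) z
    · exact ⟨h.choose, fun _ => h.choose_spec⟩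
    · exact ⟨i (x δ), fun h' => absurd h' h⟩
  choose z hz using hz
  have hcount : ∀ ξ, ∃ e : W → ℕ, Set.InjOn e (N ξ) := fun ξ =>
    Set.countable_iff_exists_injOn.1 (hN.countable ξ)
  choose e he using hcount
  obtain ⟨a', haa'⟩ := exists_gt a
  -- After the starting value `a'`, the ladder lists the levels at which the nearest element on the
  -- left changes; the color names that element within the countable set `N (lad δ n)`.
  let lad : Omega1 → ℕ → Omega1 := fun δ => jump (z δ) a'
  let c : Omega1 → ℕ → ℕ := fun δ n => e (lad δ n) (z δ (lad δ n))
  set S₁ := S ∩ {δ | Order.IsSuccLimit δ} ∩ Set.Ioi a' with hS₁_def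
  have hS₁ : IsStationary S₁ := (hS.inter_isClub isClub_isSuccLimit).inter_isClub (isClub_Ioi a')
  have hgr : ∀ δ ∈ S₁, ∀ ξ, a' ≤ ξ → ξ < δ → IsGreatest (N ξ ∩ Set.Iic (i (x δ))) (z δ ξ) :=
    fun δ hδ ξ h1 h2 => hz δ ξ (hx δ hδ.1.1 ξ (haa'.trans_le h1) h2)
  -- A value that stopped changing would be greatest at level `δ` too, because by continuity every
  -- element of `N δ` occurs earlier.
  have hchange : ∀ δ ∈ S₁, ∀ ξ, a' ≤ ξ → ξ < δ → ∃ η, ξ < η ∧ η < δ ∧ z δ η ≠ z δ ξ := by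
    intro δ hδ ξ h1 h2
    by_contra! h
    refine hx' δ hδ.1.1 ⟨z δ ξ, ⟨hN.mono h2.le (hgr δ hδ ξ h1 h2).1.1, (hgr δ hδ ξ h1 h2).1.2⟩, ?_⟩
    rintro w ⟨hw, hwx⟩
    obtain ⟨η, hη, hwη⟩ := hN.exists_lt hδ.1.2 hw
    obtain ⟨ζ, hζ, hζδ⟩ := Order.IsSuccLimit.exists_between_omega1 hδ.1.2 (max_lt h2 hη)
    have hξζ := (le_max_left _ _).trans_lt hζ
    rw [← h ζ hξζ hζδ]
    exact (hgr δ hδ ζ (h1.trans hξζ.le) hζδ).2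
      ⟨hN.mono ((le_max_right _ _).trans_lt hζ).le hwη, hwx⟩
  have hlad' : ∀ δ ∈ S₁, ∀ n, (a' ≤ lad δ n ∧ lad δ n < δ) ∧
      lad δ n < lad δ (n + 1) ∧ z δ (lad δ (n + 1)) ≠ z δ (lad δ n) := by
    intro δ hδ
    have hstep : ∀ n, (a' ≤ lad δ n ∧ lad δ n < δ) → lad δ (n + 1) < δ ∧
        lad δ n < lad δ (n + 1) ∧ z δ (lad δ (n + 1)) ≠ z δ (lad δ n) := by
      intro n hn
      obtain ⟨η, h1, h2, h3⟩ := hchange δ hδ _ hn.1 hn.2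
      exact ⟨(nextJump_le h1 h3).trans_lt h2, nextJump_spec ⟨η, h1, h3⟩⟩
    have hall : ∀ n, a' ≤ lad δ n ∧ lad δ n < δ := by
      intro n
      induction n with
      | zero => exact ⟨le_rfl, hδ.2⟩
      | succ n ih => exact ⟨ih.1.trans (hstep n ih).2.1.le, (hstep n ih).1⟩
    exact fun n => ⟨hall n, (hstep n (hall n)).2⟩
  have hlad : IsLadderSystem S₁ lad := by
    intro δ hδ
    refine ⟨strictMono_nat_of_lt_succ fun n => (hlad' δ hδ n).2.1, fun n => (hlad' δ hδ n).1.2, ?_⟩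
    -- At a limit level the nearest element already belongs to an earlier level, and from there on
    -- it is the nearest one.
    refine exists_lt_jump (fun n => (hlad' δ hδ n).2) fun η hη h1 h2 => ?_
    have hg := hgr δ hδ η h1.le h2
    obtain ⟨b, hb, hzb⟩ := hN.exists_lt hη hg.1.1
    refine ⟨max a' b, max_lt h1 hb, fun ζ h3 h4 => ?_⟩
    exact (hgr δ hδ ζ ((le_max_left _ _).trans h3) (h4.trans h2)).unique
      (isGreatest_inter_of_subset hg (hN.mono h4.le) (hN.mono ((le_max_right _ _).trans h3) hzb))
  obtain ⟨f, hf⟩ := hMA.uniformize hlad c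
  have hf' : ∀ δ, ∃ n, δ ∈ S₁ → ∀ m ≥ n, f (lad δ m) = c δ m := fun δ => by
    by_cases hδ : δ ∈ S₁
    · exact (hf δ hδ).imp fun n hn _ => hn
    · exact ⟨0, fun h => absurd h hδ⟩
  choose n hn using hf'
  -- Uniformization says nothing about indices below `n δ`. Fixing ladders and colors up to and
  -- including `n δ` covers these and forces the first difference of two ladders beyond it.
  obtain ⟨v, hS₂⟩ := hS₁.exists_const
    (fun δ => (List.range (n δ + 1)).map fun j => (lad δ j, c δ j))
    (fun ξ => {l | ∀ p ∈ l, p ∈ Set.Iic ξ ×ˢ Set.univ})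
    (fun ξ => countable_lists ((Omega1.countable_Iic ξ).prod Set.countable_univ)) (by
    intro δ hδ
    refine ⟨lad δ (n δ), (hlad' δ hδ _).1.2, fun p hp => ?_⟩
    obtain ⟨j, hj, rfl⟩ := List.mem_map.1 hp
    refine ⟨(hlad δ hδ).1.monotone ?_, trivial⟩
    have := List.mem_range.1 hj
    omega)
  set S₂ := {δ ∈ S₁ | (List.range (n δ + 1)).map (fun j => (lad δ j, c δ j)) = v}
  have hagree : ∀ δ ∈ S₂, ∀ γ ∈ S₂, n δ = n γ ∧ ∀ j ≤ n δ, lad δ j = lad γ j ∧ c δ j = c γ j := by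
    intro δ hδ γ hγ
    have h := hδ.2.trans hγ.2.symm
    have hlen : n δ = n γ := by simpa using congrArg List.length h
    refine ⟨hlen, fun j hj => ?_⟩
    rw [← hlen, List.map_inj_left] at h
    exact Prod.mk.inj (h j (List.mem_range.2 (by omega)))
  have hlt : ∀ δ ∈ S₂, ∀ γ ∈ S₂, toLex (lad δ) < toLex (lad γ) → x γ < x δ := by
    rintro δ hδ γ hγ ⟨k, hk, hkk⟩
    replace hk : ∀ j < k, lad δ j = lad γ j := hk
    replace hkk : lad δ k < lad γ k := hkk
    obtain ⟨hnn, hag⟩ := hagree δ hδ γ hγ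
    have hnk : n δ < k := by
      by_contra! h
      exact hkk.ne (hag k h).1
    obtain ⟨j, rfl⟩ : ∃ j, k = j + 1 := ⟨k - 1, by omega⟩
    have hj := hk j (by omega)
    have hcj : c δ j = c γ j := by
      rcases le_total j (n δ) with h | h
      · exact (hag j h).2
      · rw [← hn δ hδ.1 j h, ← hn γ hγ.1 j (hnn ▸ h), hj]
    have hgδ := fun m => hgr δ hδ.1 (lad δ m) (hlad' δ hδ.1 m).1.1 (hlad' δ hδ.1 m).1.2
    have hgγ := fun m => hgr γ hγ.1 (lad γ m) (hlad' γ hγ.1 m).1.1 (hlad' γ hγ.1 m).1.2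
    have hzj : z δ (lad δ j) = z γ (lad γ j) := by
      refine he (lad δ j) (hgδ j).1.1 (hj ▸ (hgγ j).1.1) ?_
      simpa only [c, hj] using hcj
    have h1 : lad δ j < lad δ (j + 1) := (hlad' δ hδ.1 j).2.1
    -- The ladder at `γ` jumps later, so `γ` still has the common neighbour at a level where `δ` has
    -- replaced it.
    have h2 : z γ (lad δ (j + 1)) = z δ (lad δ j) := by
      rw [hzj]
      exact eq_of_lt_nextJump (hj ▸ h1.le) hkk
    have h3 := hgr γ hγ.1 (lad δ (j + 1)) (hlad' δ hδ.1 _).1.1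
      (hkk.trans (hlad' γ hγ.1 _).1.2)
    rw [h2] at h3
    exact i.lt_iff_lt.1 (lt_of_isGreatest h3 (hgδ j).1.2 fun h =>
      (hlad' δ hδ.1 j).2.2 ((hgδ (j + 1)).unique h))
  refine ⟨(fun δ => toLex (lad δ)) '' S₂, ⟨S₂, lad, hS₂, fun δ hδ => hlad δ hδ.1, rfl⟩, ?_⟩
  have hch : ∀ b : ((fun δ => toLex (lad δ)) '' S₂ : Set (Lex (ℕ → Omega1))),
      ∃ δ ∈ S₂, toLex (lad δ) = b.1 := fun b => b.2
  choose g hgS hg using hch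
  refine ⟨OrderEmbedding.ofStrictMono (fun b => x (g (OrderDual.ofDual b))) fun b b' hb => ?_⟩
  refine hlt _ (hgS _) _ (hgS _) ?_
  rw [hg, hg]
  exact hb

end Core

/-! ### A criterion for being `σ`-scattered -/

section Scattered

variable {W : Type*} [LinearOrder W]

/-- `z` is the immediate neighbour of `x` in `A`, on the left or on the right. -/
def IsNeighbour (A : Set W) (x z : W) : Prop :=
  IsGreatest (A ∩ Set.Iic x) z ∨ IsLeast (A ∩ Set.Ici x) z

/-- `A` has a point between any two of its points between which there is some point. -/
def IsGapless (A : Set W) : Prop :=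
  ∀ z ∈ A, ∀ z' ∈ A, (∃ w, z < w ∧ w < z') → ∃ w ∈ A, z < w ∧ w < z'

theorem IsNeighbour.mem {A : Set W} {x z : W} (h : IsNeighbour A x z) : z ∈ A :=
  h.elim (fun h => h.1.1) fun h => h.1.1

theorem isNeighbour_self {A : Set W} {x : W} (h : x ∈ A) : IsNeighbour A x x :=
  Or.inl ⟨⟨h, le_rfl⟩, fun _ hw => hw.2⟩

theorem IsNeighbour.isGreatest {A : Set W} {x z : W} (h : IsNeighbour A x z) (hz : z ≤ x) :
    IsGreatest (A ∩ Set.Iic x) z := by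
  rcases h with h | h
  · exact h
  · exact ⟨⟨h.1.1, hz⟩, fun w hw => le_trans hw.2 h.1.2⟩

theorem IsNeighbour.isLeast {A : Set W} {x z : W} (h : IsNeighbour A x z) (hz : x ≤ z) :
    IsLeast (A ∩ Set.Ici x) z := by
  rcases h with h | h
  · exact ⟨⟨h.1.1, hz⟩, fun w hw => le_trans h.1.2 hw.2⟩
  · exact h

theorem IsNeighbour.of_subset {A B : Set W} {x z : W} (h : IsNeighbour B x z) (hA : A ⊆ B)
    (hz : z ∈ A) : IsNeighbour A x z :=
  h.imp (fun h => ⟨⟨hz, h.1.2⟩, fun _ hw => h.2 ⟨hA hw.1, hw.2⟩⟩)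
    fun h => ⟨⟨hz, h.1.2⟩, fun _ hw => h.2 ⟨hA hw.1, hw.2⟩⟩

/-- If `x` lay strictly between two distinct neighbours, gaplessness would put an element of `A`
between them, nearer to `x` than one of them. -/
theorem IsGapless.eq_of_isGreatest_of_isLeast {A : Set W} (hA : IsGapless A) {x z z' : W}
    (h : IsGreatest (A ∩ Set.Iic x) z) (h' : IsLeast (A ∩ Set.Ici x) z') : z = z' := by
  have h1 : z ≤ x := h.1.2
  have h2 : x ≤ z' := h'.1.2
  rcases h1.eq_or_lt with rfl | h1
  · exact h2.antisymm (h'.2 ⟨h.1.1, le_rfl⟩)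
  rcases h2.eq_or_lt with rfl | h2
  · exact (h.2 ⟨h'.1.1, le_rfl⟩).antisymm h1.le |>.symm
  obtain ⟨w, hw, hzw, hwz⟩ := hA z h.1.1 z' h'.1.1 ⟨x, h1, h2⟩
  rcases le_total w x with hwx | hwx
  · exact absurd (h.2 ⟨hw, hwx⟩) hzw.not_ge
  · exact absurd (h'.2 ⟨hw, hwx⟩) hwz.not_ge

theorem IsGapless.isNeighbour_unique {A : Set W} (hA : IsGapless A) {x z z' : W}
    (h : IsNeighbour A x z) (h' : IsNeighbour A x z') : z = z' := by
  rcases h with h | h <;> rcases h' with h' | h'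
  · exact h.unique h'
  · exact hA.eq_of_isGreatest_of_isLeast h h'
  · exact (hA.eq_of_isGreatest_of_isLeast h' h).symm
  · exact h.unique h'

theorem lt_of_isLeast {A : Set W} {x y z : W} (hy : IsLeast (A ∩ Set.Ici y) z) (hz : x ≤ z)
    (hx : ¬ IsLeast (A ∩ Set.Ici x) z) : x < y := by
  by_contra! h
  exact hx ⟨⟨hy.1.1, hz⟩, fun w hw => hy.2 ⟨hw.1, le_trans h hw.2⟩⟩

/-- An antitone function from the rationals to `ω₁` is constant on some interval. -/
theorem exists_Icc_const_of_antitone {φ : ℚ → Omega1} {a b : ℚ} (hab : a < b)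
    (h : ∀ q ∈ Set.Icc a b, ∀ q' ∈ Set.Icc a b, φ q < φ q' → q' < q) :
    ∃ a' b', a' < b' ∧ Set.Icc a' b' ⊆ Set.Icc a b ∧
      ∀ q ∈ Set.Icc a' b', ∀ q' ∈ Set.Icc a' b', φ q = φ q' := by
  -- Values cannot rise to the right of a point where the minimum is attained. Leaving out `b` keeps
  -- room on that side.
  obtain ⟨_, ⟨q₀, hq₀, rfl⟩, hmin⟩ := Omega1.exists_minimal
    (s := φ '' Set.Ico a b) ⟨_, a, ⟨le_rfl, hab⟩, rfl⟩
  have hb : q₀ < (q₀ + b) / 2 ∧ (q₀ + b) / 2 < b := by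
    constructor <;> linarith [hq₀.2]
  have key : ∀ q ∈ Set.Icc q₀ ((q₀ + b) / 2), φ q = φ q₀ := by
    intro q hq
    have hqI : q ∈ Set.Ico a b := ⟨hq₀.1.trans hq.1, hq.2.trans_lt hb.2⟩
    refine ((hmin _ ⟨q, hqI, rfl⟩).eq_or_lt.resolve_right fun hlt => ?_).symm
    exact (h q₀ ⟨hq₀.1, hq₀.2.le⟩ q ⟨hqI.1, hqI.2.le⟩ hlt).not_ge hq.1
  exact ⟨q₀, (q₀ + b) / 2, hb.1, Set.Icc_subset_Icc hq₀.1 hb.2.le,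
    fun q hq q' hq' => (key q hq).trans (key q' hq').symm⟩

theorem exists_Icc_const_of_monotone {φ : ℚ → Omega1} {a b : ℚ} (hab : a < b)
    (h : ∀ q ∈ Set.Icc a b, ∀ q' ∈ Set.Icc a b, φ q < φ q' → q < q') :
    ∃ a' b', a' < b' ∧ Set.Icc a' b' ⊆ Set.Icc a b ∧
      ∀ q ∈ Set.Icc a' b', ∀ q' ∈ Set.Icc a' b', φ q = φ q' := by
  have hneg : ∀ {c d q : ℚ}, q ∈ Set.Icc c d → -q ∈ Set.Icc (-d) (-c) := fun h =>
    ⟨neg_le_neg h.2, neg_le_neg h.1⟩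
  obtain ⟨a', b', h1, h2, h3⟩ := exists_Icc_const_of_antitone (φ := fun q => φ (-q))
    (neg_lt_neg hab) fun q hq q' hq' hlt => by
      have := h (-q) (by simpa using hneg hq) (-q') (by simpa using hneg hq') hlt
      linarith
  refine ⟨-b', -a', neg_lt_neg h1, fun q hq => ?_, fun q hq q' hq' => ?_⟩
  · have hq' : -q ∈ Set.Icc a' b' := by simpa using hneg hq
    have := hneg (h2 hq')
    rwa [neg_neg, neg_neg, neg_neg] at this
  · simpa using h3 (-q) (by simpa using hneg hq) (-q') (by simpa using hneg hq')

/-- If all points have a neighbour at all levels of a filtration, then the order is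
`σ`-scattered. -/
theorem isSigmaScattered_of_isNeighbour {L : Type v} [LinearOrder L] (i : L ↪o W)
    {N : Omega1 → Set W} (hN : IsFiltration N) (hgap : ∀ ξ, IsGapless (N ξ))
    (hnb : ∀ x ξ, ∃ z, IsNeighbour (N ξ) (i x) z) (hmem : ∀ x, ∃ ξ, i x ∈ N ξ) :
    IsSigmaScattered L := by
  classical
  choose z hz using hnb
  have hcount : ∀ ξ, ∃ e : W → ℕ, Set.InjOn e (N ξ) := fun ξ =>
    Set.countable_iff_exists_injOn.1 (hN.countable ξ)
  choose e he using hcount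
  let a : Omega1 := Classical.arbitrary _
  let lad : L → ℕ → Omega1 := fun x => jump (z x) a
  -- At late levels `i x` is its own neighbour, so another jump follows as long as the current
  -- neighbour differs from it.
  have hjump : ∀ x n, z x (lad x n) ≠ i x →
      lad x n < lad x (n + 1) ∧ z x (lad x (n + 1)) ≠ z x (lad x n) := by
    intro x n hn
    obtain ⟨ξ, hξ⟩ := hmem x
    obtain ⟨η, hη⟩ := exists_gt (max ξ (lad x n))
    refine nextJump_spec ⟨η, (le_max_right _ _).trans_lt hη, fun h => hn ?_⟩
    change z x η = z x (lad x n) at h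
    rw [← h]
    exact (hgap η).isNeighbour_unique (hz x η)
      (isNeighbour_self (hN.mono ((le_max_left _ _).trans hη.le) hξ))
  -- Neighbours exist at all levels, so infinitely many jumps would be unbounded in `ω₁`.
  have hterm : ∀ x, ∃ n, z x (lad x n) = i x := by
    intro x
    by_contra! h
    obtain ⟨β, hβ⟩ := Omega1.exists_forall_lt (Set.countable_range (lad x))
    obtain ⟨δ, hδ⟩ := exists_gt β
    obtain ⟨n, hn⟩ := exists_lt_jump (δ := δ) (fun n => hjump x n (h n)) (fun η hη _ _ => by
      obtain ⟨b, hb, hzb⟩ := hN.exists_lt hη (hz x η).mem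
      exact ⟨b, hb, fun ζ h1 h2 => (hgap ζ).isNeighbour_unique (hz x ζ)
        ((hz x η).of_subset (hN.mono h2.le) (hN.mono h1 hzb))⟩) β hδ
    exact (hβ _ ⟨n, rfl⟩).not_gt hn
  let n : L → ℕ := fun x => Nat.find (hterm x)
  have hn : ∀ x, z x (lad x (n x)) = i x := fun x => Nat.find_spec (hterm x)
  have hn' : ∀ x, ∀ j < n x, z x (lad x j) ≠ i x := fun x j hj => Nat.find_min (hterm x) hj
  -- The levels, of which there are uncountably many, are not recorded; a name determines its
  -- neighbour only once the level is known.
  let color : L → List (ℕ × Bool) := fun x => (List.range (n x + 1)).map fun j =>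
    (e (lad x j) (z x (lad x j)), decide (z x (lad x j) ≤ i x))
  have hcolor : ∀ x y, color x = color y → n x = n y ∧ ∀ j ≤ n x,
      e (lad x j) (z x (lad x j)) = e (lad y j) (z y (lad y j)) ∧
        (z x (lad x j) ≤ i x ↔ z y (lad y j) ≤ i y) := by
    intro x y h
    have hlen : n x = n y := by simpa [color] using congrArg List.length h
    refine ⟨hlen, fun j hj => ?_⟩
    simp only [color] at h
    rw [← hlen, List.map_inj_left] at h
    have := Prod.mk.inj (h j (List.mem_range.2 (by omega)))
    exact ⟨this.1, decide_eq_decide.1 this.2⟩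
  refine ⟨fun k => {x | Encodable.encode (color x) = k}, ?_, fun k => ⟨fun f => ?_⟩⟩
  · exact Set.eq_univ_of_forall fun x => Set.mem_iUnion.2 ⟨_, rfl⟩
  let g : ℚ → L := fun q => (f q).1
  have hg : ∀ q q', g q < g q' ↔ q < q' := fun q q' => f.lt_iff_lt
  have hcol : ∀ q q', color (g q) = color (g q') := fun q q' =>
    Encodable.encode_injective ((f q).2.trans (f q').2.symm)
  have hn0 : ∀ q, n (g q) = n (g 0) := fun q => (hcolor _ _ (hcol q 0)).1
  have heq : ∀ j ≤ n (g 0), ∀ q q', lad (g q) j = lad (g q') j →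
      z (g q) (lad (g q) j) = z (g q') (lad (g q') j) := by
    intro j hj q q' h
    have h1 := ((hcolor _ _ (hcol q q')).2 j (by rw [hn0]; exact hj)).1
    have h2 := (hz (g q') (lad (g q') j)).mem
    rw [← h] at h1 h2 ⊢
    exact he _ (hz _ _).mem h2 h1
  -- On a monochromatic copy of the rationals the jump levels are made constant one index at a time.
  -- With neighbours on the left, an earlier next jump means a larger point; on the right, a smaller
  -- one. Well-foundedness then gives a subinterval of constancy.
  have main : ∀ j ≤ n (g 0), ∃ a b, a < b ∧
      ∀ q ∈ Set.Icc a b, ∀ q' ∈ Set.Icc a b, lad (g q) j = lad (g q') j := by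
    intro j
    induction j with
    | zero => exact fun _ => ⟨0, 1, one_pos, fun _ _ _ _ => rfl⟩
    | succ j ih =>
      intro hj
      obtain ⟨a, b, hab, hconst⟩ := ih (by omega)
      have step : ∀ q ∈ Set.Icc a b, ∀ q' ∈ Set.Icc a b,
          lad (g q) (j + 1) < lad (g q') (j + 1) →
          IsNeighbour (N (lad (g q) (j + 1))) (i (g q')) (z (g q) (lad (g q) j)) ∧
          ¬ IsNeighbour (N (lad (g q) (j + 1))) (i (g q)) (z (g q) (lad (g q) j)) := by
        intro q hq q' hq' hlt
        have hj1 := hjump (g q) j (hn' _ j (by rw [hn0]; omega))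
        have h1 := hconst q hq q' hq'
        have h2 : z (g q') (lad (g q) (j + 1)) = z (g q) (lad (g q) j) := by
          rw [heq j (by omega) q q' h1]
          exact eq_of_lt_nextJump (h1 ▸ hj1.1.le) hlt
        refine ⟨h2 ▸ hz _ _, fun h => hj1.2 ?_⟩
        exact (hgap _).isNeighbour_unique (hz _ _) h
      have hside : ∀ q q', z (g q) (lad (g q) j) ≤ i (g q) ↔ z (g q') (lad (g q') j) ≤ i (g q') :=
        fun q q' => ((hcolor _ _ (hcol q q')).2 j (by rw [hn0]; omega)).2
      have hres : ∃ a' b', a' < b' ∧ Set.Icc a' b' ⊆ Set.Icc a b ∧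
          ∀ q ∈ Set.Icc a' b', ∀ q' ∈ Set.Icc a' b',
            lad (g q) (j + 1) = lad (g q') (j + 1) := by
        by_cases h0 : z (g 0) (lad (g 0) j) ≤ i (g 0)
        · refine exists_Icc_const_of_antitone hab fun q hq q' hq' hlt => ?_
          obtain ⟨h1, h2⟩ := step q hq q' hq' hlt
          have hle : z (g q) (lad (g q) j) ≤ i (g q') := by
            rw [heq j (by omega) q q' (hconst q hq q' hq')]
            exact (hside _ _).1 h0
          rw [← hg, ← i.lt_iff_lt]
          exact lt_of_isGreatest (h1.isGreatest hle) ((hside _ _).1 h0) fun h => h2 (Or.inl h)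
        · have h0' : ∀ q, i (g q) ≤ z (g q) (lad (g q) j) := fun q =>
            (not_le.1 fun h => h0 ((hside _ _).1 h)).le
          refine exists_Icc_const_of_monotone hab fun q hq q' hq' hlt => ?_
          obtain ⟨h1, h2⟩ := step q hq q' hq' hlt
          have hle : i (g q') ≤ z (g q) (lad (g q) j) := by
            rw [heq j (by omega) q q' (hconst q hq q' hq')]
            exact h0' q'
          rw [← hg, ← i.lt_iff_lt]
          exact lt_of_isLeast (h1.isLeast hle) (h0' q) fun h => h2 (Or.inr h)
      obtain ⟨a', b', h1, -, h2⟩ := hres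
      exact ⟨a', b', h1, h2⟩
  -- Equal final levels and equal colors give equal final neighbours, which are the points
  -- themselves.
  obtain ⟨a, b, hab, hconst⟩ := main _ le_rfl
  have h1 := heq _ le_rfl a b (hconst a ⟨le_rfl, hab.le⟩ b ⟨hab.le, le_rfl⟩)
  have h2 := hn (g a)
  have h3 := hn (g b)
  rw [hn0] at h2 h3
  exact ((hg a b).2 hab).ne (i.injective (h2.symm.trans (h1.trans h3)))

end Scattered

/-! ### Continuous chains of closed countable sets -/

section Chain

variable {X ι : Type*} (F : ι → List X → X)

/-- `A` is closed under the operations `F i`. -/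
def IsClosedUnder (A : Set X) : Prop :=
  ∀ i l, (∀ x ∈ l, x ∈ A) → F i l ∈ A

/-- The closure of `A` under the operations `F i`. -/
def opClosure (A : Set X) : Set X :=
  ⋂₀ {B | A ⊆ B ∧ IsClosedUnder F B}

theorem subset_opClosure (A : Set X) : A ⊆ opClosure F A :=
  Set.subset_sInter fun _ hB => hB.1

theorem isClosedUnder_opClosure (A : Set X) : IsClosedUnder F (opClosure F A) :=
  fun i l hl B hB => hB.2 i l fun x hx => hl x hx B hB

theorem opClosure_subset {A B : Set X} (h : A ⊆ B) (hB : IsClosedUnder F B) :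
    opClosure F A ⊆ B :=
  Set.sInter_subset_of_mem ⟨h, hB⟩

/-- The operations take finite lists, so `ω` stages suffice, each adding countably many values. -/
theorem countable_opClosure [Countable ι] {A : Set X} (hA : A.Countable) :
    (opClosure F A).Countable := by
  let step : Set X → Set X := fun B => B ∪ ⋃ i, F i '' {l | ∀ x ∈ l, x ∈ B}
  have hmono : Monotone fun n : ℕ => step^[n] A := monotone_nat_of_le_succ fun n => by
    rw [Function.iterate_succ_apply']
    exact Set.subset_union_left
  have hcount : ∀ n : ℕ, (step^[n] A).Countable := by
    intro n
    induction n with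
    | zero => exact hA
    | succ n ih =>
      rw [Function.iterate_succ_apply']
      exact ih.union (Set.countable_iUnion fun i => (countable_lists ih).image _)
  refine (Set.countable_iUnion hcount).mono
    (opClosure_subset F (Set.subset_iUnion (fun n : ℕ => step^[n] A) 0) fun i l hl => ?_)
  obtain ⟨n, hn⟩ : ∃ n : ℕ, ∀ x ∈ l, x ∈ step^[n] A := by
    induction l with
    | nil => exact ⟨0, by simp⟩
    | cons y l ih =>
      obtain ⟨n, hn⟩ := ih fun x hx => hl x (List.mem_cons_of_mem _ hx)
      obtain ⟨m, hm⟩ := Set.mem_iUnion.1 (hl y List.mem_cons_self)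
      refine ⟨max n m, fun x hx => ?_⟩
      rcases List.mem_cons.1 hx with rfl | hx
      · exact hmono (le_max_right n m) hm
      · exact hmono (le_max_left n m) (hn x hx)
  refine Set.mem_iUnion.2 ⟨n + 1, ?_⟩
  rw [Function.iterate_succ_apply']
  exact Or.inr (Set.mem_iUnion.2 ⟨i, l, hn, rfl⟩)

/-- The continuous chain of sets closed under `F`, adding `T η A` after the member `A` with
index `η`. -/
noncomputable def opChain (T : Omega1 → Set X → Set X) (ξ : Omega1) : Set X :=
  opClosure F (⋃ η : Set.Iio ξ, (opChain T η.1 ∪ T η.1 (opChain T η.1)))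
termination_by wellFounded_lt.wrap ξ
decreasing_by all_goals exact η.2

theorem subset_opChain (T : Omega1 → Set X → Set X) {η ξ : Omega1} (h : η < ξ) :
    opChain F T η ∪ T η (opChain F T η) ⊆ opChain F T ξ := by
  conv_rhs => rw [opChain]
  exact (Set.subset_iUnion (fun η : Set.Iio ξ => opChain F T η.1 ∪ T η.1 (opChain F T η.1))
    ⟨η, h⟩).trans (subset_opClosure F _)

theorem isClosedUnder_opChain (T : Omega1 → Set X → Set X) (ξ : Omega1) :
    IsClosedUnder F (opChain F T ξ) := by
  rw [opChain]
  exact isClosedUnder_opClosure F _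

/-- A finite list from the union of the members before a limit lies in one of them, so that union is
already closed. -/
theorem isFiltration_opChain [Countable ι] (T : Omega1 → Set X → Set X)
    (hT : ∀ ξ A, A.Countable → (T ξ A).Countable) : IsFiltration (opChain F T) := by
  have hmono : Monotone (opChain F T) := fun η ξ h => by
    rcases h.eq_or_lt with rfl | h
    · exact le_rfl
    · exact Set.subset_union_left.trans (subset_opChain F T h)
  refine ⟨hmono, fun ξ => ?_, fun {ξ} hξ {w} hw => ?_⟩
  · induction ξ using WellFoundedLT.induction with
    | _ ξ ih =>
      rw [opChain]
      have : Countable (Set.Iio ξ) :=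
        ((Omega1.countable_Iic ξ).mono Set.Iio_subset_Iic_self).to_subtype
      exact countable_opClosure F (Set.countable_iUnion fun η =>
        (ih η.1 η.2).union (hT _ _ (ih η.1 η.2)))
  · have hcl : IsClosedUnder F {w | ∃ η < ξ, w ∈ opChain F T η} := by
      intro i l hl
      obtain ⟨η, hη, h⟩ : ∃ η < ξ, ∀ x ∈ l, x ∈ opChain F T η := by
        induction l with
        | nil =>
          obtain ⟨η, hη⟩ := hξ.nonempty_Iio
          exact ⟨η, hη, by simp⟩
        | cons y l ih =>
          obtain ⟨η, hη, h⟩ := ih fun x hx => hl x (List.mem_cons_of_mem _ hx)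
          obtain ⟨ζ, hζ, hy⟩ := hl y List.mem_cons_self
          refine ⟨max η ζ, max_lt hη hζ, fun x hx => ?_⟩
          rcases List.mem_cons.1 hx with rfl | hx
          · exact hmono (le_max_right η ζ) hy
          · exact hmono (le_max_left η ζ) (h x hx)
      exact ⟨η, hη, isClosedUnder_opChain F T η i l h⟩
    rw [opChain] at hw
    refine opClosure_subset F (Set.iUnion_subset fun η w hw => ?_) hcl hw
    obtain ⟨ζ, h1, h2⟩ := hξ.exists_between_omega1 η.2
    exact ⟨ζ, h2, subset_opChain F T h1 hw⟩

end Chain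

/-! ### The completion as a linear order -/

section Cut

variable {L : Type u} [LinearOrder L]

/-- The completion of `L`. -/
def Cut (L : Type u) [LinearOrder L] : Type u := {A : Set L // IsCut A}

instance : PartialOrder (Cut L) := inferInstanceAs (PartialOrder {A : Set L // IsCut A})

noncomputable instance : LinearOrder (Cut L) where
  le_total A B := IsLowerSet.total A.2.1 B.2.1
  toDecidableLE := Classical.decRel _

/-- The points of `L` in the completion. -/
def Cut.point : L ↪o Cut L :=
  OrderEmbedding.ofStrictMono (fun x => ⟨Set.Iio x, isLowerSet_Iio x, Or.inl ⟨x, rfl⟩⟩)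
    fun _ _ h => ⟨Set.Iio_subset_Iio h.le, fun h' => lt_irrefl _ (h' h)⟩

theorem Cut.point_lt_of_mem {A : Cut L} {x : L} (h : x ∈ A.1) : Cut.point x < A :=
  ⟨fun _ hy => A.2.1 (le_of_lt hy) h, fun h' => lt_irrefl x (h' h)⟩

theorem Cut.le_point_of_notMem {A : Cut L} {x : L} (h : x ∉ A.1) : A ≤ Cut.point x :=
  fun _ hy => lt_of_not_ge fun h' => h (A.2.1 h' hy)

/-- A cut that is not a point has no greatest element; moving up once from an element of `B` outside
`A` makes both inequalities strict. -/
theorem Cut.exists_point_lt {A B : Cut L} (h : A < B) (hB : ¬ ∃ x, B = Cut.point x) :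
    ∃ x, A < Cut.point x ∧ Cut.point x < B := by
  obtain ⟨y, hyB, hyA⟩ := Set.exists_of_ssubset h
  rcases B.2.2 with ⟨x, hx⟩ | hmax
  · exact absurd ⟨x, Subtype.ext hx⟩ hB
  · obtain ⟨y', hy', hyy'⟩ := hmax y hyB
    exact ⟨y', (Cut.le_point_of_notMem hyA).trans_lt (Cut.point.lt_iff_lt.2 hyy'),
      Cut.point_lt_of_mem hy'⟩

theorem Cut.exists_lt_point {A B : Cut L} (h : A < B) (hA : ¬ ∃ x, A = Cut.point x) :
    ∃ x, A < Cut.point x ∧ Cut.point x < B := by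
  obtain ⟨y, hyB, hyA⟩ := Set.exists_of_ssubset h
  exact ⟨y, (Cut.le_point_of_notMem hyA).lt_of_ne fun h => hA ⟨y, h⟩, Cut.point_lt_of_mem hyB⟩

/-- `N` has a point of `L` between any two of its elements between which there is such a point. -/
def IsPointGapless (N : Set (Cut L)) : Prop :=
  ∀ A ∈ N, ∀ B ∈ N, (∃ x, A < Cut.point x ∧ Cut.point x < B) →
    ∃ x, Cut.point x ∈ N ∧ A < Cut.point x ∧ Cut.point x < B

theorem IsPointGapless.isGapless {N : Set (Cut L)} (hN : IsPointGapless N) : IsGapless N := by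
  rintro A hA B hB ⟨C, hAC, hCB⟩
  have : ∃ x, A < Cut.point x ∧ Cut.point x < B := by
    by_cases hC : ∃ x, C = Cut.point x
    · obtain ⟨x, rfl⟩ := hC
      exact ⟨x, hAC, hCB⟩
    · obtain ⟨x, h1, h2⟩ := Cut.exists_point_lt hAC hC
      exact ⟨x, h1, h2.trans hCB⟩
  obtain ⟨x, hx, h⟩ := hN A hA B hB this
  exact ⟨_, hx, h⟩

/-- A cut from which `x` is not separated by points in `N` yields a neighbour of `x` in `N`. -/
theorem IsPointGapless.exists_isNeighbour {N : Set (Cut L)} (hN : IsPointGapless N) {x : L}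
    {A : Cut L} (hA : A ∈ N) (h : ∀ y, Cut.point y ∈ N →
      ¬ (A < Cut.point y ∧ y < x) ∧ ¬ (x < y ∧ Cut.point y < A)) :
    ∃ z, IsNeighbour N (Cut.point x) z := by
  by_cases hx : Cut.point x ∈ N
  · exact ⟨_, isNeighbour_self hx⟩
  refine ⟨A, ?_⟩
  -- The hypothesis excludes only points; a nearer cut in `N` that is not a point would, by
  -- gaplessness, produce an excluded point.
  rcases le_total A (Cut.point x) with hAx | hAx
  · refine Or.inl ⟨⟨hA, hAx⟩, fun B hB => ?_⟩
    by_contra! hAB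
    by_cases hBp : ∃ y, B = Cut.point y
    · obtain ⟨y, rfl⟩ := hBp
      refine (h y hB.1).1 ⟨hAB, Cut.point.lt_iff_lt.1 (lt_of_le_of_ne hB.2 fun he => hx ?_)⟩
      exact he ▸ hB.1
    · obtain ⟨y, hy, h1, h2⟩ := hN A hA B hB.1 (Cut.exists_point_lt hAB hBp)
      exact (h y hy).1 ⟨h1, Cut.point.lt_iff_lt.1 (h2.trans_le hB.2)⟩
  · refine Or.inr ⟨⟨hA, hAx⟩, fun B hB => ?_⟩
    by_contra! hAB
    by_cases hBp : ∃ y, B = Cut.point y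
    · obtain ⟨y, rfl⟩ := hBp
      refine (h y hB.1).2 ⟨Cut.point.lt_iff_lt.1 (lt_of_le_of_ne hB.2 fun he => hx ?_), hAB⟩
      exact he ▸ hB.1
    · obtain ⟨y, hy, h1, h2⟩ := hN B hB.1 A hA (Cut.exists_lt_point hAB hBp)
      exact (h y hy).2 ⟨Cut.point.lt_iff_lt.1 (lt_of_le_of_lt hB.2 h1), h2⟩

end Cut

/-! ### A continuous chain of countable elementary submodels -/

theorem H.mem_of_mem {θ : Cardinal.{u}} {x y : ZFSet.{u}} (hx : x ∈ H θ) (h : y ∈ x) : y ∈ H θ := by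
  obtain ⟨t, ht, hxt, hc⟩ := hx
  exact ⟨t, ht, ht.subset_of_mem (hxt h), hc⟩

instance : Countable setLanguage.Symbols := by
  have h : ∀ l, Countable (setLanguage.Functions l) := fun l => inferInstanceAs (Countable Empty)
  have h' : ∀ l, Countable (setLanguage.Relations l) := fun l => by
    have : Subsingleton (MemRel l) := ⟨fun a b => by cases a; cases b; rfl⟩
    exact inferInstanceAs (Countable (MemRel l))
  exact inferInstanceAs (Countable ((Σ l, setLanguage.Functions l) ⊕ Σ l, setLanguage.Relations l))

instance : Countable (Σ n, setLanguage.BoundedFormula Empty (n + 1)) :=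
  Function.Injective.countable (β := Σ n, setLanguage.BoundedFormula Empty n)
    (f := fun φ => ⟨φ.1 + 1, φ.2⟩) (by
      rintro ⟨n, φ⟩ ⟨m, ψ⟩ h
      simp only [Sigma.mk.injEq, add_left_inj] at h
      obtain ⟨rfl, h⟩ := h
      rw [eq_of_heq h])

open Classical in
/-- An enumeration of the set `W`, if there is one. -/
noncomputable def enumerate (W : ZFSet.{u}) : ℕ → ZFSet.{u} :=
  if h : ∃ e : ℕ → ZFSet.{u}, (W : Set ZFSet.{u}) = Set.range e then h.choose else fun _ => ∅

theorem coe_eq_range_enumerate {W : ZFSet.{u}} (h : W.card = ℵ₀) :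
    (W : Set ZFSet.{u}) = Set.range (enumerate W) := by
  have hW : #W = ℵ₀ := by rw [ZFSet.cardinalMk_coe_sort, h, Cardinal.lift_aleph0]
  have hc : (W : Set ZFSet.{u}).Countable := Cardinal.le_aleph0_iff_set_countable.1 hW.le
  have hne : (W : Set ZFSet.{u}).Nonempty := by
    rw [Set.nonempty_iff_ne_empty]
    intro he
    have : IsEmpty W := Set.isEmpty_coe_sort.2 he
    rw [Cardinal.mk_eq_zero] at hW
    exact Cardinal.aleph0_ne_zero hW.symm
  have hex := hc.exists_eq_range hne
  rw [enumerate, dif_pos hex]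
  exact hex.choose_spec

section Models

variable {L : Type u} (c : L ↪ ZFSet.{u})

theorem mem_carrierSet {z : ZFSet.{u}} : z ∈ carrierSet c ↔ ∃ x, c x = z := ZFSet.mem_range

theorem mem_code {A : Set L} {x : L} : c x ∈ code c A ↔ x ∈ A := by
  simp [code]

theorem code_injective : Function.Injective (code c) := fun A B h => by
  ext x
  rw [← mem_code c, h, mem_code]

theorem code_subset (A : Set L) : code c A ⊆ carrierSet c := by
  intro z hz
  obtain ⟨x, rfl⟩ := ZFSet.mem_range.1 hz
  exact (mem_carrierSet c).2 ⟨x, rfl⟩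

theorem iterate_powerset_mem_H (n : ℕ) :
    ZFSet.powerset^[n] (carrierSet c) ∈ H (theta (carrierSet c)) :=
  (theta_spec (carrierSet c)).2 n

theorem code_mem_H (A : Set L) : code c A ∈ H (theta (carrierSet c)) :=
  H.mem_of_mem (iterate_powerset_mem_H c 1) (ZFSet.mem_powerset.2 (code_subset c A))

variable [LinearOrder L]

theorem mem_completionSet {z : ZFSet.{u}} :
    z ∈ completionSet c ↔ ∃ A : Cut L, code c A.1 = z := by
  rw [completionSet, ZFSet.mem_sep, ZFSet.mem_powerset]
  constructor
  · rintro ⟨-, A, hA, rfl⟩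
    exact ⟨⟨A, hA⟩, rfl⟩
  · rintro ⟨A, rfl⟩
    exact ⟨code_subset c _, A.1, A.2, rfl⟩

theorem mem_H_of_subset_completionSet {Z : ZFSet.{u}} (h : Z ⊆ completionSet c) :
    Z ∈ H (theta (carrierSet c)) :=
  H.mem_of_mem (iterate_powerset_mem_H c 2)
    (ZFSet.mem_powerset.2 fun _ hz => (ZFSet.mem_sep.1 (h hz)).1)

theorem orderSet_mem_H : orderSet c ∈ H (theta (carrierSet c)) := by
  suffices h : orderSet c ∈ (carrierSet c).powerset.powerset.powerset from
    H.mem_of_mem (iterate_powerset_mem_H c 3) h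
  refine ZFSet.mem_powerset.2 fun z hz => ?_
  obtain ⟨p, rfl⟩ := ZFSet.mem_range.1 hz
  have h : ∀ x, c x ∈ carrierSet c := fun x => (mem_carrierSet c).2 ⟨x, rfl⟩
  refine ZFSet.mem_powerset.2 fun w hw => ZFSet.mem_powerset.2 fun v hv => ?_
  rcases ZFSet.mem_pair.1 hw with rfl | rfl
  · rw [ZFSet.mem_singleton.1 hv]
    exact h _
  · rcases ZFSet.mem_pair.1 hv with rfl | rfl <;> exact h _

/-- The trace of `M` on the completion of `L`. -/
noncomputable def trace (M : Set ZFSet.{u}) : ZFSet.{u} :=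
  (completionSet c).sep (· ∈ M)

theorem mem_trace {M : Set ZFSet.{u}} {z : ZFSet.{u}} :
    z ∈ trace c M ↔ z ∈ completionSet c ∧ z ∈ M := ZFSet.mem_sep

theorem trace_subset (M : Set ZFSet.{u}) : trace c M ⊆ completionSet c := ZFSet.sep_subset

/-- One step in building an increasing sequence in the club that absorbs prescribed cuts. `Infinite
L` ensures that the club is nonempty. -/
theorem IsClubCountable.exists_mem [Infinite L] {E : ZFSet.{u}}
    (hE : IsClubCountable (completionSet c) E) (Z y : ZFSet.{u}) :
    ∃ W ∈ E, (Z ∈ E → Z ⊆ W) ∧ (y ∈ completionSet c → y ∈ W) := by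
  have hne : ∃ W, W ∈ E := by
    let s : ℕ → ZFSet.{u} := fun n => code c (Cut.point (Infinite.natEmbedding L n)).1
    have hs : Function.Injective s := fun n m h => (Infinite.natEmbedding L).injective
      (Cut.point.injective (Subtype.ext (code_injective c h)))
    obtain ⟨W, hW, -⟩ := hE.2.1 (ZFSet.range s) (fun z hz => by
      obtain ⟨n, rfl⟩ := ZFSet.mem_range.1 hz
      exact (mem_completionSet c).2 ⟨_, rfl⟩) (by
      rw [← Cardinal.lift_inj.{u, u + 1}, ← ZFSet.cardinalMk_coe_sort, Cardinal.lift_aleph0]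
      have : (ZFSet.range s : Set ZFSet.{u}) = Set.range s := ZFSet.coe_range s
      change #((ZFSet.range s : Set ZFSet.{u})) = ℵ₀
      rw [this]
      simpa using Cardinal.mk_range_eq_of_injective hs)
    exact ⟨W, hW⟩
  wlog hZ : Z ∈ E generalizing Z
  · obtain ⟨Z', hZ'⟩ := hne
    obtain ⟨W, hW, -, h⟩ := this Z' hZ'
    exact ⟨W, hW, fun h => absurd h hZ, h⟩
  by_cases hy : y ∈ completionSet c
  swap
  · exact ⟨Z, hZ, fun _ => subset_rfl, fun h => absurd h hy⟩
  by_cases hyZ : y ∈ Z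
  · exact ⟨Z, hZ, fun _ => subset_rfl, fun _ => hyZ⟩
  obtain ⟨hZs, hZc⟩ := hE.1 Z hZ
  obtain ⟨W, hW, hZW⟩ := hE.2.1 (insert y Z) (fun z hz => by
    rcases ZFSet.mem_insert_iff.1 hz with rfl | hz
    · exact hy
    · exact hZs hz) (by rw [ZFSet.card_insert hyZ, hZc, Cardinal.add_one_eq le_rfl])
  exact ⟨W, hW, fun _ z hz => hZW (ZFSet.mem_insert_of_mem _ hz),
    fun _ => hZW (ZFSet.mem_insert _ _)⟩

/-- The relations for which the members of the chain have to contain witnesses: the formulas of the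
language of set theory, being the `k`-th element of a countable set, being a point between two cuts,
and being an element of a club that extends a given element by a given point. -/
def WitnessRel : (Σ n, setLanguage.BoundedFormula Empty (n + 1)) ⊕ ℕ ⊕ Bool →
    List (H (theta (carrierSet c))) → H (theta (carrierSet c)) → Prop
  | .inl φ, l, a => ∃ x : Fin φ.1 → H (theta (carrierSet c)),
      l = List.ofFn x ∧ φ.2.Realize default (Fin.snoc x a : _ → H (theta (carrierSet c)))
  | .inr (.inl k), l, a => ∃ W, l = [W] ∧ a.1 = enumerate W.1 k
  | .inr (.inr true), l, a => ∃ (A B : Cut L) (x : L), l.map Subtype.val = [code c A.1, code c B.1] ∧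
      a.1 = code c (Cut.point x).1 ∧ A < Cut.point x ∧ Cut.point x < B
  | .inr (.inr false), l, a => ∃ E Z y, l = [E, Z, y] ∧
      a.1 ∈ E.1 ∧ (Z.1 ∈ E.1 → Z.1 ⊆ a.1) ∧ (y.1 ∈ completionSet c → y.1 ∈ a.1)

/-- `A` contains witnesses for all the relations `WitnessRel c i`. -/
def HasWitnesses (A : Set (H (theta (carrierSet c)))) : Prop :=
  ∀ i l, (∀ x ∈ l, x ∈ A) → (∃ a, WitnessRel c i l a) → ∃ a ∈ A, WitnessRel c i l a

section HasWitnesses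

variable {c} {A : Set (H (theta (carrierSet c)))}

/-- The witnesses for formulas give the Tarski–Vaught test, and without function symbols every
subset is a substructure. -/
theorem HasWitnesses.mem_elementarySubmodels (hA : HasWitnesses c A) (hcount : A.Countable)
    (h : carrierSet c ∈ Subtype.val '' A) (h' : orderSet c ∈ Subtype.val '' A) :
    Subtype.val '' A ∈ elementarySubmodels c := by
  refine ⟨hcount.image _, ?_, h, h'⟩
  let S : setLanguage.Substructure (H (theta (carrierSet c))) := ⟨A, fun f => f.elim⟩
  refine ⟨S.toElementarySubstructure fun n φ x a ha => ?_, rfl⟩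
  obtain ⟨b, hb, x', hx', hφ⟩ := hA (.inl ⟨n, φ⟩) (List.ofFn fun j => (x j).1)
    (fun y hy => by
      obtain ⟨j, rfl⟩ := List.mem_ofFn.1 hy
      exact (x j).2) ⟨a, _, rfl, ha⟩
  have := List.ofFn_injective hx'
  subst this
  exact ⟨⟨b, hb⟩, hφ⟩

theorem HasWitnesses.isPointGapless (hA : HasWitnesses c A) :
    IsPointGapless {B : Cut L | code c B.1 ∈ Subtype.val '' A} := by
  rintro B ⟨b, hb, hbB⟩ D ⟨d, hd, hdD⟩ ⟨x, hx⟩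
  obtain ⟨a, ha, B', D', x', hl, hax, h1, h2⟩ := hA (.inr (.inr true)) [b, d] (by simp [hb, hd])
    ⟨⟨_, code_mem_H c _⟩, B, D, x, by simp [hbB, hdD], rfl, hx⟩
  simp only [List.map_cons, List.map_nil, List.cons.injEq, and_true, hbB, hdD] at hl
  have hB : B = B' := Subtype.ext (code_injective c hl.1)
  have hD : D = D' := Subtype.ext (code_injective c hl.2)
  subst hB hD
  exact ⟨x', ⟨a, ha, hax⟩, h1, h2⟩

/-- The trace is the union of an increasing sequence in `E ∩ A` that absorbs the cuts in `A` one by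
one. Nothing else enters, because `A` contains all elements of its countable members through their
enumerations. -/
theorem HasWitnesses.trace_mem [Infinite L] (hA : HasWitnesses c A) (hcount : A.Countable)
    {E : ZFSet.{u}} (hEA : E ∈ Subtype.val '' A) (hE : IsClubCountable (completionSet c) E) :
    trace c (Subtype.val '' A) ∈ E := by
  obtain ⟨E, hEA, rfl⟩ := hEA
  have hext : ∀ Z y, ∃ a, Z ∈ A → y ∈ A → a ∈ A ∧ a.1 ∈ E.1 ∧ (Z.1 ∈ E.1 → Z.1 ⊆ a.1) ∧
      (y.1 ∈ completionSet c → y.1 ∈ a.1) := by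
    intro Z y
    by_cases h : Z ∈ A ∧ y ∈ A
    · obtain ⟨W, hW, h1, h2⟩ := hE.exists_mem c Z.1 y.1
      obtain ⟨a, ha, E', Z', y', hl, h3⟩ := hA (.inr (.inr false)) [E, Z, y]
        (by simp [hEA, h.1, h.2]) ⟨⟨W, H.mem_of_mem E.2 hW⟩, E, Z, y, rfl, hW, h1, h2⟩
      simp only [List.cons.injEq, and_true] at hl
      obtain ⟨rfl, rfl, rfl⟩ := hl
      exact ⟨a, fun _ _ => ⟨ha, h3⟩⟩
    · exact ⟨E, fun h1 h2 => absurd ⟨h1, h2⟩ h⟩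
  choose ext hext using hext
  obtain ⟨y, hy⟩ := hcount.exists_eq_range ⟨E, hEA⟩
  have hyA : ∀ n, y n ∈ A := fun n => hy ▸ ⟨n, rfl⟩
  let f : ℕ → H (theta (carrierSet c)) := fun n => Nat.rec (ext E E) (fun n Z => ext Z (y n)) n
  have hf0 : f 0 = ext E E := rfl
  have hfs : ∀ n, f (n + 1) = ext (f n) (y n) := fun _ => rfl
  have hf : ∀ n, f n ∈ A ∧ (f n).1 ∈ E.1 := by
    intro n
    induction n with
    | zero =>
      rw [hf0]
      exact ⟨(hext E E hEA hEA).1, (hext E E hEA hEA).2.1⟩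
    | succ n ih =>
      rw [hfs]
      have := hext (f n) (y n) ih.1 (hyA n)
      exact ⟨this.1, this.2.1⟩
  have hfn : ∀ n, (f n).1 ⊆ (f (n + 1)).1 ∧
      ((y n).1 ∈ completionSet c → (y n).1 ∈ (f (n + 1)).1) := fun n => by
    have := (hext (f n) (y n) (hf n).1 (hyA n)).2.2
    rw [hfs]
    exact ⟨this.1 (hf n).2, this.2⟩
  have hU := hE.2.2 (fun n => (f n).1) (fun n => (hf n).2) fun n => (hfn n).1
  convert hU
  ext z
  rw [mem_trace, ZFSet.mem_iUnion]
  constructor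
  · rintro ⟨hz, a, ha, rfl⟩
    rw [hy] at ha
    obtain ⟨n, rfl⟩ := ha
    exact ⟨n + 1, (hfn n).2 hz⟩
  · rintro ⟨n, hn⟩
    obtain ⟨hs, hcard⟩ := hE.1 _ (hf n).2
    refine ⟨hs hn, ?_⟩
    have hz : z ∈ ((f n).1 : Set ZFSet.{u}) := hn
    rw [coe_eq_range_enumerate hcard] at hz
    obtain ⟨k, rfl⟩ := hz
    obtain ⟨a, ha, W, hl, haW⟩ := hA (.inr (.inl k)) [f n] (by simp [(hf n).1])
      ⟨⟨_, H.mem_of_mem (f n).2 hn⟩, f n, rfl, rfl⟩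
    simp only [List.cons.injEq, and_true] at hl
    subst hl
    exact ⟨a, ha, haW⟩

end HasWitnesses

/-- A continuous chain of countable elementary submodels, covering the points of `L`. -/
structure IsModelChain (M : Omega1 → Set ZFSet.{u}) : Prop where
  isFiltration : IsFiltration M
  mem_elementarySubmodels : ∀ η ξ, η < ξ → M ξ ∈ elementarySubmodels c
  trace_mem : ∀ η ξ, η < ξ → trace c (M η) ∈ M ξ
  exists_mem : ∀ x : L, ∃ ξ, code c (Cut.point x).1 ∈ M ξ
  isPointGapless : ∀ ξ, IsPointGapless {A : Cut L | code c A.1 ∈ M ξ}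
  trace_mem_club : ∀ ξ, ∀ E ∈ M ξ, IsClubCountable (completionSet c) E → trace c (M ξ) ∈ E

/-- Chosen witnesses act as Skolem functions, and each member is closed under them. Stage `ξ` also
adds the `ξ`-th point of `L` and the trace of the current member. -/
theorem exists_isModelChain (hcard : #L = ℵ₁) : ∃ M, IsModelChain c M := by
  classical
  have hinf : Infinite L := Cardinal.infinite_iff.2 (hcard ▸ Cardinal.aleph0_le_aleph 1)
  obtain ⟨e⟩ : Nonempty (Omega1 ≃ L) := by
    rw [← Cardinal.lift_mk_eq'.{1, u}, hcard]
    simp [Cardinal.mk_Iio_ordinal]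
  let X := H (theta (carrierSet c))
  let dflt : X := ⟨carrierSet c, iterate_powerset_mem_H c 0⟩
  let F : (Σ n, setLanguage.BoundedFormula Empty (n + 1)) ⊕ ℕ ⊕ Bool → List X → X := fun i l =>
    if h : ∃ a, WitnessRel c i l a then h.choose else dflt
  let T : Omega1 → Set X → Set X := fun ξ A =>
    {dflt, ⟨orderSet c, orderSet_mem_H c⟩, ⟨code c (Cut.point (e ξ)).1, code_mem_H c _⟩,
      ⟨trace c (Subtype.val '' A), mem_H_of_subset_completionSet c (trace_subset c _)⟩}
  have hT : ∀ ξ A, A.Countable → (T ξ A).Countable := fun ξ A _ =>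
    Set.Finite.countable (by simp [T])
  have hM := isFiltration_opChain F T hT
  have hW : ∀ ξ, HasWitnesses c (opChain F T ξ) := by
    intro ξ i l hl h
    refine ⟨F i l, isClosedUnder_opChain F T ξ i l hl, ?_⟩
    simp only [F, dif_pos h]
    exact h.choose_spec
  have hTM : ∀ η ξ, η < ξ → T η (opChain F T η) ⊆ opChain F T ξ := fun η ξ h =>
    Set.subset_union_right.trans (subset_opChain F T h)
  refine ⟨fun ξ => Subtype.val '' opChain F T ξ, ⟨fun η ξ h => Set.image_mono (hM.mono h),
    fun ξ => (hM.countable ξ).image _, fun {ξ} hξ {w} hw => ?_⟩, fun η ξ h => ?_, fun η ξ h => ?_,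
    fun x => ?_, fun ξ => (hW ξ).isPointGapless,
    fun ξ E hE hE' => (hW ξ).trace_mem (hM.countable ξ) hE hE'⟩
  · obtain ⟨w, hw, rfl⟩ := hw
    obtain ⟨η, hη, hw⟩ := hM.exists_lt hξ hw
    exact ⟨η, hη, w, hw, rfl⟩
  · exact (hW ξ).mem_elementarySubmodels (hM.countable ξ)
      ⟨_, hTM η ξ h (Or.inl rfl), rfl⟩ ⟨_, hTM η ξ h (Or.inr (Or.inl rfl)), rfl⟩
  · exact ⟨_, hTM η ξ h (Or.inr (Or.inr (Or.inr rfl))), rfl⟩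
  · obtain ⟨ξ, hξ⟩ := exists_gt (e.symm x)
    refine ⟨ξ, _, hTM _ ξ hξ (Or.inr (Or.inr (Or.inl rfl))), ?_⟩
    simp

end Models

/-! ### The main construction -/

section Main

variable {L : Type u} [LinearOrder L] {c : L ↪ ZFSet.{u}}

/-- The cuts of `L` that belong to `M`. -/
def cutsIn (c : L ↪ ZFSet.{u}) (M : Set ZFSet.{u}) : Set (Cut L) :=
  {A | code c A.1 ∈ M}

theorem IsFiltration.cutsIn {M : Omega1 → Set ZFSet.{u}} (hM : IsFiltration M) :
    IsFiltration fun ξ => cutsIn c (M ξ) where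
  mono _ _ h _ hA := hM.mono h hA
  countable ξ := (hM.countable ξ).preimage_of_injOn
    (((code_injective c).comp Subtype.val_injective).injOn)
  exists_lt hξ _ hA := hM.exists_lt hξ hA

theorem exists_isNeighbour_of_captures {M : Set ZFSet.{u}} (hM : IsPointGapless (cutsIn c M))
    {x : L} (h : Captures c (trace c M) x) : ∃ z, IsNeighbour (cutsIn c M) (Cut.point x) z := by
  obtain ⟨A, hA, hAM, hy⟩ := h
  refine hM.exists_isNeighbour (A := ⟨A, hA⟩) ((mem_trace c).1 hAM).2 fun y hyM => ?_
  exact hy y ((mem_trace c).2 ⟨(mem_completionSet c).2 ⟨Cut.point y, rfl⟩, hyM⟩)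

/-- In an order that is not `σ`-scattered, stationarily many members of a chain of models have a
point without a neighbour. -/
theorem IsModelChain.isStationary {M : Omega1 → Set ZFSet.{u}} (hM : IsModelChain c M)
    (hL : ¬ IsSigmaScattered L) :
    IsStationary {δ | ∃ x, ¬ ∃ z, IsNeighbour (cutsIn c (M δ)) (Cut.point x) z} := by
  intro D hD
  by_contra hne
  rw [Set.not_nonempty_iff_eq_empty] at hne
  -- Reindexing the chain along a club `D` missing the set leaves only levels at which every point
  -- has a neighbour.
  refine hL (isSigmaScattered_of_isNeighbour Cut.point (hM.isFiltration.cutsIn.comp_next hD)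
    (fun ξ => (hM.isPointGapless _).isGapless) (fun x ξ => ?_) fun x => ?_)
  · by_contra hx
    exact Set.eq_empty_iff_forall_notMem.1 hne (hD.next ξ) ⟨⟨x, hx⟩, hD.next_mem ξ⟩
  · obtain ⟨ξ, hξ⟩ := hM.exists_mem x
    exact ⟨ξ, hM.isFiltration.mono (hD.le_next ξ) hξ⟩

/-- In an amenable order, a point has a neighbour in all members of the chain between the first one
that contains the relevant club and a given one. -/
theorem IsModelChain.exists_forall_isNeighbour {M : Omega1 → Set ZFSet.{u}} (hM : IsModelChain c M)
    (hc : IsAmenableVia c) {δ : Omega1} (hδ : Order.IsSuccLimit δ) (x : L) :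
    ∃ a < δ, ∀ ξ, a ≤ ξ → ξ < δ → ∃ z, IsNeighbour (cutsIn c (M ξ)) (Cut.point x) z := by
  obtain ⟨η, hη⟩ := hδ.nonempty_Iio
  obtain ⟨E, hEM, hE, hcap⟩ := hc _ (hM.mem_elementarySubmodels η δ hη) x
  -- By continuity the club `E` appears at some `a < δ`. For `ξ` in `[a, δ)` the trace of `M ξ` then
  -- belongs both to `E` and to `M δ`, so it captures `x`.
  obtain ⟨a, ha, hEa⟩ := hM.isFiltration.exists_lt hδ hEM
  exact ⟨a, ha, fun ξ h1 h2 => exists_isNeighbour_of_captures (hM.isPointGapless ξ)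
    (hcap _ (hM.trace_mem_club ξ E (hM.isFiltration.mono h1 hEa) hE) (hM.trace_mem ξ δ h2))⟩

/-- For a filtration, the levels at which a point has a neighbour on the left form an open set. -/
theorem IsFiltration.isOpen_setOf_isGreatest {W : Type*} [LinearOrder W] {N : Omega1 → Set W}
    (hN : IsFiltration N) (x : W) (δ : Omega1) :
    IsOpen {ξ | ξ < δ ∧ ∃ z, IsGreatest (N ξ ∩ Set.Iic x) z} := by
  rw [SuccOrder.isOpen_iff]
  rintro ξ ⟨hξδ, z, hz⟩ hξ
  obtain ⟨b, hb, hzb⟩ := hN.exists_lt hξ hz.1.1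
  exact ⟨b, hb, fun η hη => ⟨hη.2.trans hξδ, z,
    isGreatest_inter_of_subset hz (hN.mono hη.2.le) (hN.mono hη.1.le hzb)⟩⟩

theorem IsStationary.exists_bound {S : Set Omega1} (hS : IsStationary S)
    {p : Omega1 → Omega1 → Prop} (hp : ∀ δ ∈ S, ∃ a < δ, p δ a) :
    ∃ a, IsStationary {δ ∈ S | p δ a} := by
  have h : ∀ δ, ∃ a, δ ∈ S → a < δ ∧ p δ a := fun δ => by
    by_cases hδ : δ ∈ S
    · obtain ⟨a, ha⟩ := hp δ hδ
      exact ⟨a, fun _ => ha⟩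
    · exact ⟨δ, fun h => absurd h hδ⟩
  choose F hF using h
  obtain ⟨a, ha⟩ := hS.exists_const F (fun ξ => {ξ}) (fun ξ => Set.countable_singleton ξ)
    fun δ hδ => ⟨F δ, (hF δ hδ).1, rfl⟩
  refine ⟨a, ha.mono fun δ hδ => ⟨hδ.1, ?_⟩⟩
  have := (hF δ hδ.1).2
  rwa [hδ.2] at this

theorem IsStationary.or {S : Set Omega1} (hS : IsStationary S) {p q : Omega1 → Prop}
    (h : ∀ δ ∈ S, p δ ∨ q δ) : IsStationary {δ ∈ S | p δ} ∨ IsStationary {δ ∈ S | q δ} := by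
  classical
  obtain ⟨v, hv⟩ := (hS.inter_isClub isClub_isSuccLimit).exists_const
    (fun δ => decide (p δ)) (fun _ => Set.univ) (fun _ => Set.to_countable _)
    fun δ hδ => by
      obtain ⟨a, ha⟩ := Order.IsSuccLimit.nonempty_Iio hδ.2
      exact ⟨a, ha, trivial⟩
  cases v
  · exact Or.inr (hv.mono fun δ hδ =>
      ⟨hδ.1.1, (h δ hδ.1.1).resolve_left (of_decide_eq_false hδ.2)⟩)
  · exact Or.inl (hv.mono fun δ hδ => ⟨hδ.1.1, of_decide_eq_true hδ.2⟩)

/-- A version of `exists_isBaumgartnerType` where the approximation is only known at levels in a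
club. -/
theorem exists_isBaumgartnerType_of_isClub (hMA : MartinsAxiomOmega1.{u}) {W : Type*}
    [LinearOrder W] {L : Type v} [LinearOrder L]
    (i : L ↪o W) {N : Omega1 → Set W} (hN : IsFiltration N) {E S : Set Omega1} (hE : IsClub E)
    (hS : IsStationary S) (x : Omega1 → L) (a : Omega1)
    (hx : ∀ δ ∈ S, ∀ ξ ∈ E, a < ξ → ξ < δ → ∃ z, IsGreatest (N ξ ∩ Set.Iic (i (x δ))) z)
    (hx' : ∀ δ ∈ S, ¬ ∃ z, IsGreatest (N δ ∩ Set.Iic (i (x δ))) z) :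
    ∃ B : Set (Lex (ℕ → Omega1)), IsBaumgartnerType B ∧ Nonempty ((B : Type 1)ᵒᵈ ↪o L) := by
  refine exists_isBaumgartnerType hMA i (hN.comp_next hE) (hS.inter_isClub hE.limitPoints) x a
    (fun δ hδ ξ h1 h2 => ?_) fun δ hδ => ?_
  · obtain ⟨b, hb, hξb, hbδ⟩ := hδ.2.2 ξ h2
    exact hx δ hδ.1 _ (hE.next_mem ξ) (h1.trans_le (hE.le_next ξ))
      ((hE.next_le hb hξb.le).trans_lt hbδ)
  · have hδE : δ ∈ E := Omega1.isClosed_iff.1 hE.1 δ hδ.2.1 hδ.2.2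
    simpa only [hE.next_eq hδE] using hx' δ hδ.1

end Main

end LinearOrderBasis

open LinearOrderBasis in
/-- Under Martin's axiom for `ℵ₁` dense sets and `(†)`, every amenable non `σ`-scattered linear order
of size `ℵ₁` contains a copy of a Baumgartner type or of the reverse of one. -/
theorem theorem3p1
    (hMA : LinearOrderBasis.MartinsAxiomOmega1.{u})
    (hDagger : LinearOrderBasis.Dagger)
    (L : Type u) [LinearOrder L]
    (hcard : Cardinal.mk L = Cardinal.aleph 1)
    (hL : ¬ LinearOrderBasis.IsSigmaScattered L)
    (hamenable : LinearOrderBasis.IsAmenable L) :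
    ∃ B : Set (Lex (ℕ → LinearOrderBasis.Omega1)),
      LinearOrderBasis.IsBaumgartnerType B ∧
        (Nonempty (B ↪o L) ∨ Nonempty ((B : Type 1)ᵒᵈ ↪o L)) := by
  obtain ⟨c, hc⟩ := hamenable
  obtain ⟨M, hM⟩ := exists_isModelChain c hcard
  let N : Omega1 → Set (Cut L) := fun ξ => cutsIn c (M ξ)
  have hN : IsFiltration N := hM.isFiltration.cutsIn
  have hS₀ := (hM.isStationary hL).inter_isClub isClub_isSuccLimit
  have hx : ∀ δ, ∃ x, (∃ x, ¬ ∃ z, IsNeighbour (N δ) (Cut.point x) z) →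
      ¬ ∃ z, IsNeighbour (N δ) (Cut.point x) z := fun δ => by
    by_cases h : ∃ x, ¬ ∃ z, IsNeighbour (N δ) (Cut.point x) z
    · exact ⟨h.choose, fun _ => h.choose_spec⟩
    · have : Nonempty L := Cardinal.mk_ne_zero_iff.1 (hcard ▸ (Cardinal.aleph_pos 1).ne')
      exact ⟨Classical.arbitrary L, fun h' => absurd h' h⟩
  choose x hx using hx
  obtain ⟨a, hS₁⟩ := hS₀.exists_bound fun δ hδ =>
    hM.exists_forall_isNeighbour hc hδ.2 (x δ)
  -- The open sets collect the levels with a neighbour on the left, so homogeneity on `E` fixes the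
  -- side.
  obtain ⟨E, hE, hS₂⟩ := hDagger _
    (fun δ => {ξ | ξ < δ ∧ ∃ z, IsGreatest (N ξ ∩ Set.Iic (Cut.point (x δ))) z}) hS₁
    fun δ _ => ⟨fun ξ hξ => hξ.1, hN.isOpen_setOf_isGreatest _ δ⟩
  obtain ⟨b, hS₃⟩ := hS₂.exists_bound fun δ hδ => hδ.2
  rcases hS₃.or fun δ hδ => hδ.2 with hS | hS
  · obtain ⟨B, hB, hBL⟩ := exists_isBaumgartnerType_of_isClub hMA Cut.point hN hE hS x b
      (fun δ hδ ξ hξ h1 h2 => (hδ.2 ⟨hξ, h1, h2⟩).2)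
      fun δ hδ ⟨z, hz⟩ => hx δ hδ.1.1.1.1.1.1 ⟨z, Or.inl hz⟩
    exact ⟨B, hB, Or.inr hBL⟩
  -- Here the neighbours lie on the right, which is the left in the dual order; a reversed type in
  -- `Lᵒᵈ` is a Baumgartner type in `L`.
  · have hN' : IsFiltration fun ξ => (OrderDual.ofDual ⁻¹' N ξ : Set (Cut L)ᵒᵈ) :=
      ⟨hN.mono, hN.countable, hN.exists_lt⟩
    obtain ⟨B, hB, ⟨f⟩⟩ := exists_isBaumgartnerType_of_isClub hMA (L := Lᵒᵈ)
      Cut.point.dual hN' hE hS (fun δ => OrderDual.toDual (x δ)) (max a b)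
      (fun δ hδ ξ hξ h1 h2 => by
        obtain ⟨z, hz⟩ := hδ.1.1.1.1.2 ξ ((le_max_left a b).trans h1.le) h2
        refine ⟨OrderDual.toDual z, hz.resolve_left fun hz => ?_⟩
        exact Set.eq_empty_iff_forall_notMem.1 hδ.2 ξ
          ⟨⟨hξ, (le_max_right a b).trans_lt h1, h2⟩, h2, z, hz⟩)
      fun δ hδ ⟨z, hz⟩ => hx δ hδ.1.1.1.1.1.1 ⟨OrderDual.ofDual z, Or.inr hz⟩
    exact ⟨B, hB, Or.inl ⟨OrderEmbedding.ofStrictMono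
      (fun b => OrderDual.ofDual (f (OrderDual.toDual b)))
      fun b b' h => f.lt_iff_lt.2 (OrderDual.toDual_lt_toDual.2 h)⟩⟩
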